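/- Let $n\in\{6,7,8\}$, let $h=12,18,30$ respectively be the Coxeter number of the Dynkin diagram $E_n$, and let $Q$ be any quiver of type $E_n$, i.e. any orientation of the diagram $E_n$. Then there is a stable $h$-gon $\mathbf V$ of type $E_n$ such that $\mathcal Q^{1-?}(\mathbf V)\cong Q$ as graded quivers, where $Q$ carries the trivial grading (all arrows in degree $0$) and $\mathcal Q^{1-?}(\mathbf V)$ is obtained from the intersection quiver $\mathcal Q(\mathbf V)$ by replacing each degree $d$ by $1-d$. Here the following terminology is used. *Polygons.* An $h$-gon of type $E_n$ is a labelled polygon in $\mathbb C$ with vertices $V_j$ and edges $z_j=V_{j-1}V_j\neq0$, $j\in\mathbb Z/h$ (we write $XY$ for the vector from $X$ to $Y$), such that for all $j$: - $E_6$: $z_j+z_{j+4}+z_{j+8}=0$ and $z_j-z_{j-3}+z_{j-6}-z_{j-9}=0$; - $E_7$: $\mathbf V$ is centrally symmetric and $z_j+z_{j+1}+z_{j+6}+z_{j+7}+z_{j+12}+z_{j+13}=0$; - $E_8$: $\mathbf V$ is centrally symmetric, $z_j+z_{j+10}+z_{j+20}=0$ and $z_j+z_{j+6}+z_{j+12}+z_{j+18}+z_{j+24}=0$.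 Its inner points $W_j$, $j\in\mathbb Z/h$, are given by $V_jW_j=z_{j+4}$ for $E_6$, $V_jW_j=z_{j+5}$ for $E_7$, and $V_{j+1}W_j=z_{j+11}$ for $E_8$. The polygon is *stable* if, for every $j$, all vertices other than $V_{j-1},V_j$ are strictly on the left hand side of the edge $V_{j-1}V_j$, and all inner points are strictly on the left hand side of every diagonal $V_jV_{j+n-3}$. *Diagonals.* The admissible diagonals are the oriented diagonals $\pm V_jV_{j+s}$ $(1\le s\le n-3)$, $\pm W_jW_{j+2}$, $\pm V_{j-1}W_{j+2}$ and $\pm V_{j-1}W_{j+1}$; two oriented diagonals with endpoints among the labelled points $V_j,W_j$ are identified if they are equal as vectors in every $h$-gon of type $E_n$. Points are ordered by $(x_1,y_1)<(x_2,y_2)$ iff $y_1<y_2$, or $y_1=y_2$ and $x_1<x_2$. A diagonal is upward if its argument lies in $[0,\pi)$; $\overline{XY}$ denotes the upward one of $XY$ and $YX$. *$\operatorname{Im}Z$-indecomposable diagonals.* Relabel the polygon cyclically so that $V_1,\dots,V_{n-3}$ are the $n-3$ lowest points among all $V_j,W_j$. Consider the parallel triangles $V_0W_1W_3$ and $W_2W_4V_{n-2}$,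 and take the lower one (the first if $W_1<W_4$, the second if $W_4<W_1$). Let $\mathbf J_n$ be the convex hull of $V_1,\dots,V_{n-3}$ and the vertices of this triangle. The set $\operatorname{Sim}\mathbf V$ consists of the diagonals joining consecutive vertices of $\mathbf J_n$ in increasing order (denoted $s_1,s_2,s_4,\dots,s_n$ from top to bottom), together with $s_3=\overline{V_0W_2}$. *Intersection quiver.* The graded quiver $\mathcal Q(\mathbf V)$ has vertex set $\operatorname{Sim}\mathbf V$. There is one arrow $a\to b$ if there is an essential oriented intersection from $a$ to $b$, i.e. a non-degenerate triangle $PXY$ with $P,X,Y$ among the labelled points $V_j,W_j$, all of whose edges represent admissible diagonals up to orientation, with $\overline{PX}=a$, $\overline{PY}=b$, and whose interior angle at $P$, turning from $PX$ to $PY$, is anticlockwise; otherwise there is no arrow $a\to b$. The degree of the arrow is its intersection index: $0$ if $\arg a<\arg b$ and $1$ if $\arg b<\arg a$. -/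

import Mathlib

universe u v u' v'

set_option linter.checkUnivs false

namespace ExcGon

/-! ### Dynkin types `E₆`, `E₇`, `E₈` and quivers of these types -/

inductive ExcType
  | E6
  | E7
  | E8

/-- The number `n` of vertices of the Dynkin diagram `E_n`. -/
def ExcType.rank : ExcType → ℕ
  | .E6 => 6
  | .E7 => 7
  | .E8 => 8

/-- The Coxeter number `h` of the Dynkin diagram `E_n`. -/
def ExcType.coxeter : ExcType → ℕ
  | .E6 => 12
  | .E7 => 18
  | .E8 => 30

def ExcType.cartan : (t : ExcType) → Matrix (Fin t.rank) (Fin t.rank) ℤ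
  | .E6 => CartanMatrix.E₆
  | .E7 => CartanMatrix.E₇
  | .E8 => CartanMatrix.E₈

/-- `Q` is an orientation of the Dynkin diagram `E_n`: between two vertices that are adjacent in the
diagram there is exactly one arrow, in exactly one of the two directions; there are no other arrows
(the diagonal entries of the Cartan matrix are `2`, so there are no loops). -/
def IsQuiverOfType (t : ExcType) (Q : Type u) [Quiver.{v} Q] : Prop :=
  ∃ e : Q ≃ Fin t.rank, ∀ a b : Q,
    if t.cartan (e a) (e b) = -1 then Nonempty (Unique ((a ⟶ b) ⊕ (b ⟶ a))) else IsEmpty (a ⟶ b)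

/-! ### Graded quivers -/

structure GradedQuiver where
  Vertex : Type u
  Arrow : Vertex → Vertex → Type v
  deg : ∀ {a b : Vertex}, Arrow a b → ℤ

/-- The grading change `? ↦ 1 - ?`. -/
def GradedQuiver.gradingChange (G : GradedQuiver.{u, v}) : GradedQuiver.{u, v} where
  Vertex := G.Vertex
  Arrow := G.Arrow
  deg := fun x => 1 - G.deg x

/-- An ordinary quiver, seen as a graded quiver with trivial grading. -/
def GradedQuiver.ofQuiver (Q : Type u) [Quiver.{v} Q] : GradedQuiver.{u, v} where
  Vertex := Q
  Arrow := fun a b => a ⟶ b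
  deg := fun _ => 0

/-- Isomorphisms of graded quivers. -/
structure GradedQuiver.Iso (G : GradedQuiver.{u, v}) (H : GradedQuiver.{u', v'}) where
  onVertex : G.Vertex ≃ H.Vertex
  onArrow : ∀ a b : G.Vertex, G.Arrow a b ≃ H.Arrow (onVertex a) (onVertex b)
  deg_eq : ∀ (a b : G.Vertex) (x : G.Arrow a b), H.deg (onArrow a b x) = G.deg x

/-! ### Plane geometry -/

/-- The order on the points of the plane: compare heights first, then abscissas. -/
def PLt (P Q : ℂ) : Prop := P.im < Q.im ∨ (P.im = Q.im ∧ P.re < Q.re)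

/-- The determinant of a pair of plane vectors. The point `P` is (strictly) on the left hand side of
the oriented line from `A` to `B` iff `0 < cross (B - A) (P - A)`. -/
def cross (z w : ℂ) : ℝ := z.re * w.im - z.im * w.re

/-! ### `h`-gons of type `E_n` -/

/-- The edge `z_j = V_{j-1}V_j` of a polygon with vertices `V_j`. -/
def edge {h : ℕ} (p : ZMod h → ℂ) (j : ZMod h) : ℂ := p j - p (j - 1)

/-- Central symmetry: `V_{j+m}` is the reflection of `V_j` in some fixed centre `O`. -/
def IsCentrallySymmetric {h : ℕ} (m : ZMod h) (p : ZMod h → ℂ) : Prop :=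
  ∃ O : ℂ, ∀ j, p (j + m) - O = -(p j - O)

/-- The conditions on a polygon with vertices `V_j`, `j ∈ ℤ/h`, to be of type `E_n`. -/
def TypeRelations : (t : ExcType) → (ZMod t.coxeter → ℂ) → Prop
  | .E6, p =>
      ∀ j, edge p j + edge p (j + 4) + edge p (j + 8) = 0 ∧
        edge p j - edge p (j - 3) + edge p (j - 6) - edge p (j - 9) = 0
  | .E7, p =>
      IsCentrallySymmetric 9 p ∧
        ∀ j, edge p j + edge p (j + 1) + edge p (j + 6) + edge p (j + 7)
          + edge p (j + 12) + edge p (j + 13) = 0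
  | .E8, p =>
      IsCentrallySymmetric 15 p ∧
        ∀ j, edge p j + edge p (j + 10) + edge p (j + 20) = 0 ∧
          edge p j + edge p (j + 6) + edge p (j + 12) + edge p (j + 18) + edge p (j + 24) = 0

/-- An `h`-gon of type `E_n`, where `h` is the Coxeter number: a labelled polygon with vertices
`V_j`, `j ∈ ℤ/h`, and non-zero edges, subject to the relations of the type. -/
structure HGon (t : ExcType) where
  vertex : ZMod t.coxeter → ℂ
  edge_ne_zero : ∀ j, edge vertex j ≠ 0
  relations : TypeRelations t vertex

/-- The inner points `W_j`: `V_j W_j = z_{j+4}` for `E₆`, `V_j W_j = z_{j+5}` for `E₇`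
and `V_{j+1} W_j = z_{j+11}` for `E₈`. -/
def innerPoint : (t : ExcType) → (ZMod t.coxeter → ℂ) → ZMod t.coxeter → ℂ
  | .E6, p, j => p j + edge p (j + 4)
  | .E7, p, j => p j + edge p (j + 5)
  | .E8, p, j => p (j + 1) + edge p (j + 11)

/-- The labels `V_j` and `W_j` of the vertices and of the inner points. -/
inductive Label (t : ExcType)
  | V (j : ZMod t.coxeter)
  | W (j : ZMod t.coxeter)

/-- The point of the plane with a given label. -/
def HGon.pt {t : ExcType} (G : HGon t) : Label t → ℂ
  | .V j => G.vertex j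
  | .W j => innerPoint t G.vertex j

/-- All vertices other than `V_{j-1}`, `V_j` are on the left hand side of the edge `V_{j-1}V_j`. -/
def HGon.PositivelyConvex {t : ExcType} (G : HGon t) : Prop :=
  ∀ i j, i ≠ j → i ≠ j - 1 → 0 < cross (edge G.vertex j) (G.vertex i - G.vertex (j - 1))

/-- The inside of the level-`s` diagonal-gon: the points on the left hand side of all the length-`s`
diagonals `V_j V_{j+s}`. -/
def HGon.insideLevel {t : ExcType} (G : HGon t) (s : ℕ) : Set ℂ :=
  {P | ∀ j : ZMod t.coxeter, 0 < cross (G.vertex (j + s) - G.vertex j) (P - G.vertex j)}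

/-- Stability: positively convex, and the inner points are inside the level-`(n-3)` diagonal-gon. -/
def HGon.Stable {t : ExcType} (G : HGon t) : Prop :=
  G.PositivelyConvex ∧ ∀ j, innerPoint t G.vertex j ∈ G.insideLevel (t.rank - 3)

/-! ### Admissible diagonals -/

/-- The vector `PQ` in the plane, for a pair of labels `(P, Q)`. -/
def HGon.vecPair {t : ExcType} (G : HGon t) (d : Label t × Label t) : ℂ := G.pt d.2 - G.pt d.1

/-- Two oriented diagonals (pairs of labels) are equivalent if they are equal as vectors by virtue of
the relations of the type, i.e. if they are the same vector in every `h`-gon of that type. -/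
def DiagEquiv {t : ExcType} (d d' : Label t × Label t) : Prop :=
  ∀ G : HGon t, G.vecPair d = G.vecPair d'

def diagSetoid (t : ExcType) : Setoid (Label t × Label t) where
  r := DiagEquiv
  iseqv :=
    { refl := fun _ _ => rfl
      symm := fun hd G => (hd G).symm
      trans := fun hd hd' G => (hd G).trans (hd' G) }

/-- Equivalence classes of oriented diagonals. -/
def Diag (t : ExcType) : Type := Quotient (diagSetoid t)

/-- The class of the oriented diagonal from `P` to `Q`. -/
def Diag.mk {t : ExcType} (P Q : Label t) : Diag t := Quotient.mk (diagSetoid t) (P, Q)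

/-- The vector in the plane of a class of oriented diagonals. -/
def HGon.vec {t : ExcType} (G : HGon t) (d : Diag t) : ℂ :=
  Quotient.lift G.vecPair (fun x y (hd : DiagEquiv x y) => hd G) d

/-- The diagonals `V_j V_{j+s}` with `1 ≤ s ≤ n - 3`, and `W_j W_{j+2}`, `V_{j-1} W_{j+2}`,
`V_{j-1} W_{j+1}`. -/
inductive IsBasicDiag {t : ExcType} : Label t → Label t → Prop
  | VV (j : ZMod t.coxeter) (s : ℕ) (h1 : 1 ≤ s) (h2 : s ≤ t.rank - 3) :
      IsBasicDiag (.V j) (.V (j + s))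
  | WW (j : ZMod t.coxeter) : IsBasicDiag (.W j) (.W (j + 2))
  | VW2 (j : ZMod t.coxeter) : IsBasicDiag (.V (j - 1)) (.W (j + 2))
  | VW1 (j : ZMod t.coxeter) : IsBasicDiag (.V (j - 1)) (.W (j + 1))

/-- The admissible diagonals, up to equivalence: the above ones, in both orientations. -/
def Diag.Admissible {t : ExcType} (d : Diag t) : Prop :=
  ∃ P Q : Label t, IsBasicDiag P Q ∧ (d = Diag.mk P Q ∨ d = Diag.mk Q P)

open Classical in
/-- The upward version of the diagonal with endpoints `P` and `Q`. -/
noncomputable def HGon.up {t : ExcType} (G : HGon t) (P Q : Label t) : Diag t :=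
  if PLt (G.pt P) (G.pt Q) then Diag.mk P Q else Diag.mk Q P

/-! ### The `Im Z`-indecomposable diagonals -/

/-- The labels `V_{k+1}, …, V_{k+n-3}`. -/
def bottom (t : ExcType) (k : ZMod t.coxeter) : Set (Label t) :=
  {P | ∃ i : ℕ, 1 ≤ i ∧ i ≤ t.rank - 3 ∧ P = .V (k + i)}

/-- `V_{k+1}, …, V_{k+n-3}` are the `n - 3` lowest ones among all the points `V_j`, `W_j`.
(Usually one relabels the polygon so that `k = 0`.) -/
def HGon.IsBase {t : ExcType} (G : HGon t) (k : ZMod t.coxeter) : Prop :=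
  ∀ P ∈ bottom t k, ∀ R, R ∉ bottom t k → PLt (G.pt P) (G.pt R)

open Classical in
/-- The lower one of the two parallel triangles `V_k W_{k+1} W_{k+3}` and
`W_{k+2} W_{k+4} V_{k+n-2}`. -/
noncomputable def HGon.triangle {t : ExcType} (G : HGon t) (k : ZMod t.coxeter) : Set (Label t) :=
  if PLt (G.pt (.W (k + 1))) (G.pt (.W (k + 4))) then
    {.V k, .W (k + 1), .W (k + 3)}
  else {.W (k + 2), .W (k + 4), .V (k + (t.rank - 2 : ℕ))}

/-- The vertices of the convex hull of the points `V_{k+1}, …, V_{k+n-3}` and of the triangle. -/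
noncomputable def HGon.hullVertices {t : ExcType} (G : HGon t) (k : ZMod t.coxeter) :
    Set (Label t) :=
  {P | P ∈ bottom t k ∪ G.triangle k ∧
    G.pt P ∈ Set.extremePoints ℝ (convexHull ℝ (G.pt '' (bottom t k ∪ G.triangle k)))}

/-- The `Im Z`-indecomposable diagonals: the diagonals that join consecutive vertices, in increasing
order, of the above convex hull (these are `s₁, s₂, s₄, …, s_n`), and the upward diagonal
`s₃` with endpoints `V_k`, `W_{k+2}`. -/
def HGon.Sim {t : ExcType} (G : HGon t) : Set (Diag t) :=
  {d | ∃ k, G.IsBase k ∧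
    ((∃ P ∈ G.hullVertices k, ∃ Q ∈ G.hullVertices k, PLt (G.pt P) (G.pt Q) ∧
        (∀ R ∈ G.hullVertices k, ¬ (PLt (G.pt P) (G.pt R) ∧ PLt (G.pt R) (G.pt Q))) ∧
        d = Diag.mk P Q) ∨
      d = G.up (.V k) (.W (k + 2)))}

/-! ### The intersection quiver -/

/-- There is an essential oriented intersection from the upward diagonal `a` to the upward diagonal
`b`: some triangle `P X Y` whose edges are (equivalent to) admissible diagonals has `a` as its
edge `PX` and `b` as its edge `PY` (up to orientation), and the interior angle at `P`, turning from
`a` to `b`, is anticlockwise. -/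
def HGon.Essential {t : ExcType} (G : HGon t) (a b : Diag t) : Prop :=
  a.Admissible ∧ b.Admissible ∧
    ∃ P X Y : Label t, a = G.up P X ∧ b = G.up P Y ∧ (Diag.mk X Y).Admissible ∧
      0 < cross (G.pt X - G.pt P) (G.pt Y - G.pt P)

/-- The intersection index of an oriented intersection from `a` to `b`. (For upward diagonals
the argument is in `[0, π)`, where `Complex.arg` is the usual angle.) -/
noncomputable def HGon.index {t : ExcType} (G : HGon t) (a b : Diag t) : ℤ :=
  if (G.vec a).arg < (G.vec b).arg then 0 else 1

/-- The intersection quiver: its vertices are the `Im Z`-indecomposable diagonals, its arrows are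
the essential oriented intersections (at most one from one given diagonal to another), graded by
their intersection indices. -/
noncomputable def HGon.intersectionQuiver {t : ExcType} (G : HGon t) : GradedQuiver.{0, 0} where
  Vertex := G.Sim
  Arrow := fun a b => PLift (G.Essential a b)
  deg := fun {a b} _ => G.index a b

end ExcGon

namespace ExcGon

/-! ### Polygons given by sequences of points -/

/-! There is a universal `h`-gon in the root lattice, and every `h`-gon of type `E_n` is its image
in the plane. Indeed, the type relations force the edges to satisfy a linear recursion of order `n`
whose characteristic polynomial is that of a Coxeter element. The first `n` edges therefore
determine the polygon up to translation. In the lattice these edges form a basis, so every polygon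
comes, up to translation, from the lattice polygon by an additive map to `ℂ`, a central charge
(`SeqRel.exists_charge`). Conversely, generic charges give polygons. Hence two diagonals agree in
all polygons exactly when their lattice vectors agree (`Diag.mk_eq_mk_iff`), and equivalence of
diagonals becomes a finite computation.

Admissible diagonals are roots. Let `α`, `β` be simple diagonals whose scalar products are given by
the Cartan matrix, and let a triangle `PXY` have `PX = aα`, `PY = bβ` with signs `a`, `b`, and a
root as third edge. Then `2 = 4 - 2ab(α, β)`, so `α` and `β` are adjacent in the Dynkin diagram and
`ab = -1` (`units_mul_of_form_eq`). Such a triangle turns anticlockwise at `P` exactly when `β` is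
clockwise from `α`. So the sign of one cross product orients each Dynkin edge, no other pair has an
arrow (`essential_iff`), and every arrow has index `1`, that is, degree `0` after the grading
change.

It remains to realise all sign patterns on the `n - 1` Dynkin edges by stable polygons. This is done
by `32`, `64` and `128` explicit integral polygons, for which stability, the lowest points, the
convex hull, the scalar products, the signs and the required triangles are verified by computation
(`checkAll_E6`, `checkAll_E7`, `checkAll_E8`). -/

instance (t : ExcType) : NeZero t.coxeter := ⟨by cases t <;> decide⟩

/-- The relations of an `h`-gon with vertices `p k`, written without subtraction. -/
def polyRel {A : Type*} [AddCommMonoid A] : ExcType → (ℕ → A) → ℕ → Prop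
  | .E6, p, k =>
      p (k + 1) + p (k + 5) + p (k + 9) = p k + p (k + 4) + p (k + 8) ∧
        p (k + 1) + p (k + 3) + p (k + 7) + p (k + 9) = p k + p (k + 4) + p (k + 6) + p (k + 10)
  | .E7, p, k =>
      p k + p (k + 9) = p 0 + p 9 ∧
        p (k + 2) + p (k + 8) + p (k + 14) = p k + p (k + 6) + p (k + 12)
  | .E8, p, k =>
      p k + p (k + 15) = p 0 + p 15 ∧
        p (k + 1) + p (k + 11) + p (k + 21) = p k + p (k + 10) + p (k + 20) ∧
        p (k + 1) + p (k + 7) + p (k + 13) + p (k + 19) + p (k + 25) =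
          p k + p (k + 6) + p (k + 12) + p (k + 18) + p (k + 24)

/-- The relation that expresses an inner point `w` by the vertices, written without subtraction. -/
def innerRel {A : Type*} [AddCommMonoid A] : ExcType → (ℕ → A) → A → ℕ → Prop
  | .E6, p, w, k => w + p (k + 3) = p k + p (k + 4)
  | .E7, p, w, k => w + p (k + 4) = p k + p (k + 5)
  | .E8, p, w, k => w + p (k + 10) = p (k + 1) + p (k + 11)

/-- The vertices of a sequence of `2 h` points, the first `h` of which are seen as vertices, the
others as inner points. -/
def vtx {A : Type*} (t : ExcType) (g : ℕ → A) (k : ℕ) : A := g (k % t.coxeter)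

/-- The inner points of a sequence of `2 h` points. -/
def inn {A : Type*} (t : ExcType) (g : ℕ → A) (k : ℕ) : A := g (t.coxeter + k % t.coxeter)

theorem vtx_mod_add {A : Type*} (t : ExcType) (g : ℕ → A) (k m : ℕ) :
    vtx t g (k % t.coxeter + m) = vtx t g (k + m) := by
  simp [vtx]

section

variable {A : Type*} [AddCommMonoid A]

instance [DecidableEq A] (t : ExcType) (p : ℕ → A) (k : ℕ) : Decidable (polyRel t p k) := by
  cases t <;> unfold polyRel <;> infer_instance

instance [DecidableEq A] (t : ExcType) (p : ℕ → A) (w : A) (k : ℕ) :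
    Decidable (innerRel t p w k) := by
  cases t <;> unfold innerRel <;> infer_instance

theorem polyRel.map {B : Type*} [AddCommMonoid B] (f : A →+ B) {t : ExcType} {p : ℕ → A} {k : ℕ}
    (h : polyRel t p k) : polyRel t (fun k => f (p k)) k := by
  cases t <;> simp only [polyRel, ← map_add] at h ⊢
  · rw [h.1, h.2]; simp
  · rw [h.1, h.2]; simp
  · rw [h.1, h.2.1, h.2.2]; simp

theorem innerRel.map {B : Type*} [AddCommMonoid B] (f : A →+ B) {t : ExcType} {p : ℕ → A} {w : A}
    {k : ℕ} (h : innerRel t p w k) : innerRel t (fun k => f (p k)) (f w) k := by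
  cases t <;> simp only [innerRel, ← map_add] at h ⊢ <;> rw [h]

def SeqRelAt (t : ExcType) (g : ℕ → A) (k : ℕ) : Prop :=
  polyRel t (vtx t g) k ∧ innerRel t (vtx t g) (inn t g k) k

instance [DecidableEq A] (t : ExcType) (g : ℕ → A) (k : ℕ) : Decidable (SeqRelAt t g k) := by
  unfold SeqRelAt; infer_instance

/-- The points `g 0, …, g (2 h - 1)` satisfy the relations between the vertices and the inner points
of an `h`-gon. -/
def SeqRel (t : ExcType) (g : ℕ → A) : Prop := ∀ k, SeqRelAt t g k

/-- The relations depend on `k` only modulo `h`, so that finitely many of them suffice. -/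
theorem SeqRel.of_lt {t : ExcType} {g : ℕ → A} (h : ∀ k < t.coxeter, SeqRelAt t g k) :
    SeqRel t g := by
  intro k
  have := h _ (Nat.mod_lt k (NeZero.pos t.coxeter))
  have h0 := vtx_mod_add t g k 0
  have h1 : inn t g (k % t.coxeter) = inn t g k := by simp [inn]
  rw [add_zero, add_zero] at h0
  cases t <;> simpa only [SeqRelAt, polyRel, innerRel, vtx_mod_add, h0, h1] using this

/-- Relations without subtraction survive additive maps out of any commutative monoid. This moves
polygons to `ℂ` both from the root lattice, by a charge, and from `ℕ × ℕ`, by `natPt`. -/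
theorem SeqRel.map {B : Type*} [AddCommMonoid B] (f : A →+ B) {t : ExcType} {g : ℕ → A}
    (h : SeqRel t g) : SeqRel t (fun c => f (g c)) :=
  fun k => ⟨(h k).1.map f, (h k).2.map f⟩

end

/-! ### From relations between edges to relations between vertices -/

theorem edge_succ {h : ℕ} (p : ZMod h → ℂ) (k : ℕ) :
    edge p ((k + 1 : ℕ) : ZMod h) = p ((k + 1 : ℕ) : ZMod h) - p (k : ZMod h) := by
  simp [edge]

theorem exists_eq_natCast_succ {h : ℕ} [NeZero h] (j : ZMod h) :
    ∃ k : ℕ, j = ((k + 1 : ℕ) : ZMod h) :=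
  ⟨(j - 1).val, by simp⟩

theorem typeRelations_iff_E6 (p : ZMod 12 → ℂ) :
    TypeRelations .E6 p ↔ ∀ k : ℕ, polyRel .E6 (fun k => p (k : ZMod 12)) k := by
  change (∀ j : ZMod 12, edge p j + edge p (j + 4) + edge p (j + 8) = 0 ∧
      edge p j - edge p (j - 3) + edge p (j - 6) - edge p (j - 9) = 0) ↔ _
  have key : ∀ k : ℕ,
      (edge p ((k + 1 : ℕ) : ZMod 12) + edge p (((k + 1 : ℕ) : ZMod 12) + 4)
          + edge p (((k + 1 : ℕ) : ZMod 12) + 8) = 0 ∧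
        edge p ((k + 1 : ℕ) : ZMod 12) - edge p (((k + 1 : ℕ) : ZMod 12) - 3)
          + edge p (((k + 1 : ℕ) : ZMod 12) - 6) - edge p (((k + 1 : ℕ) : ZMod 12) - 9) = 0) ↔
      polyRel .E6 (fun k => p (k : ZMod 12)) k := by
    intro k
    have h0 : (12 : ZMod 12) = 0 := by decide
    have e1 : ((k + 1 : ℕ) : ZMod 12) + 4 = ((k + 4 + 1 : ℕ) : ZMod 12) := by push_cast; ring
    have e2 : ((k + 1 : ℕ) : ZMod 12) + 8 = ((k + 8 + 1 : ℕ) : ZMod 12) := by push_cast; ring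
    -- Backward shifts become forward shifts modulo `12`, so that all indices are casts of natural
    -- numbers.
    have e3 : ((k + 1 : ℕ) : ZMod 12) - 3 = ((k + 9 + 1 : ℕ) : ZMod 12) := by
      push_cast; linear_combination -h0
    have e4 : ((k + 1 : ℕ) : ZMod 12) - 6 = ((k + 6 + 1 : ℕ) : ZMod 12) := by
      push_cast; linear_combination -h0
    have e5 : ((k + 1 : ℕ) : ZMod 12) - 9 = ((k + 3 + 1 : ℕ) : ZMod 12) := by
      push_cast; linear_combination -h0
    rw [e1, e2, e3, e4, e5]
    simp only [edge_succ, polyRel, add_assoc, Nat.reduceAdd]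
    refine and_congr ⟨fun h => ?_, fun h => ?_⟩ ⟨fun h => ?_, fun h => ?_⟩ <;>
      linear_combination h
  refine ⟨fun h k => (key k).1 (h _), fun h j => ?_⟩
  obtain ⟨k, rfl⟩ := exists_eq_natCast_succ (h := 12) j
  exact (key k).2 (h k)

theorem typeRelations_iff_E7 (p : ZMod 18 → ℂ) :
    TypeRelations .E7 p ↔ ∀ k : ℕ, polyRel .E7 (fun k => p (k : ZMod 18)) k := by
  change (IsCentrallySymmetric (h := 18) 9 p ∧
    ∀ j : ZMod 18, edge p j + edge p (j + 1) + edge p (j + 6)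
      + edge p (j + 7) + edge p (j + 12) + edge p (j + 13) = 0) ↔ _
  have key : ∀ k : ℕ,
      edge p ((k + 1 : ℕ) : ZMod 18) + edge p (((k + 1 : ℕ) : ZMod 18) + 1)
          + edge p (((k + 1 : ℕ) : ZMod 18) + 6) + edge p (((k + 1 : ℕ) : ZMod 18) + 7)
          + edge p (((k + 1 : ℕ) : ZMod 18) + 12) + edge p (((k + 1 : ℕ) : ZMod 18) + 13) = 0 ↔
      p (k + 2 : ℕ) + p (k + 8 : ℕ) + p (k + 14 : ℕ)
        = p (k : ℕ) + p (k + 6 : ℕ) + p (k + 12 : ℕ) := by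
    intro k
    have e1 : ((k + 1 : ℕ) : ZMod 18) + 1 = ((k + 1 + 1 : ℕ) : ZMod 18) := by push_cast; ring
    have e2 : ((k + 1 : ℕ) : ZMod 18) + 6 = ((k + 6 + 1 : ℕ) : ZMod 18) := by push_cast; ring
    have e3 : ((k + 1 : ℕ) : ZMod 18) + 7 = ((k + 7 + 1 : ℕ) : ZMod 18) := by push_cast; ring
    have e4 : ((k + 1 : ℕ) : ZMod 18) + 12 = ((k + 12 + 1 : ℕ) : ZMod 18) := by push_cast; ring
    have e5 : ((k + 1 : ℕ) : ZMod 18) + 13 = ((k + 13 + 1 : ℕ) : ZMod 18) := by push_cast; ring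
    rw [e1, e2, e3, e4, e5]
    simp only [edge_succ, add_assoc, Nat.reduceAdd]
    constructor <;> intro h <;> linear_combination h
  -- A centre exists exactly when sums of opposite vertices are constant; the centre is half of that
  -- sum.
  have cs : IsCentrallySymmetric (h := 18) 9 p ↔
      ∀ k : ℕ, p (k : ℕ) + p (k + 9 : ℕ) = p (0 : ℕ) + p (9 : ℕ) := by
    constructor
    · rintro ⟨O, hO⟩ k
      have h1 := hO k
      have h2 := hO (0 : ℕ)
      rw [← sub_eq_zero] at h1 h2 ⊢
      push_cast at h1 h2 ⊢
      rw [zero_add] at h2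
      linear_combination h1 - h2
    · refine fun h => ⟨(p (0 : ℕ) + p (9 : ℕ)) / 2, fun j => ?_⟩
      obtain ⟨k, rfl⟩ := exists_eq_natCast_succ (h := 18) j
      have h1 := h (k + 1)
      push_cast at h1 ⊢
      linear_combination h1
  refine ⟨fun h k => ⟨cs.1 h.1 k, (key k).1 (h.2 _)⟩, fun h => ⟨cs.2 fun k => (h k).1, fun j => ?_⟩⟩
  obtain ⟨k, rfl⟩ := exists_eq_natCast_succ (h := 18) j
  exact (key k).2 (h k).2

theorem typeRelations_iff_E8 (p : ZMod 30 → ℂ) :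
    TypeRelations .E8 p ↔ ∀ k : ℕ, polyRel .E8 (fun k => p (k : ZMod 30)) k := by
  change (IsCentrallySymmetric (h := 30) 15 p ∧
    ∀ j : ZMod 30, edge p j + edge p (j + 10) + edge p (j + 20) = 0 ∧
      edge p j + edge p (j + 6) + edge p (j + 12) + edge p (j + 18) + edge p (j + 24) = 0) ↔ _
  have key : ∀ k : ℕ,
      (edge p ((k + 1 : ℕ) : ZMod 30) + edge p (((k + 1 : ℕ) : ZMod 30) + 10)
          + edge p (((k + 1 : ℕ) : ZMod 30) + 20) = 0 ∧
        edge p ((k + 1 : ℕ) : ZMod 30) + edge p (((k + 1 : ℕ) : ZMod 30) + 6)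
          + edge p (((k + 1 : ℕ) : ZMod 30) + 12) + edge p (((k + 1 : ℕ) : ZMod 30) + 18)
          + edge p (((k + 1 : ℕ) : ZMod 30) + 24) = 0) ↔
      (p (k + 1 : ℕ) + p (k + 11 : ℕ) + p (k + 21 : ℕ)
          = p (k : ℕ) + p (k + 10 : ℕ) + p (k + 20 : ℕ) ∧
        p (k + 1 : ℕ) + p (k + 7 : ℕ) + p (k + 13 : ℕ) + p (k + 19 : ℕ) + p (k + 25 : ℕ) =
          p (k : ℕ) + p (k + 6 : ℕ) + p (k + 12 : ℕ) + p (k + 18 : ℕ) + p (k + 24 : ℕ)) := by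
    intro k
    have e (m : ℕ) : ((k + 1 : ℕ) : ZMod 30) + (m : ℕ) = ((k + m + 1 : ℕ) : ZMod 30) := by
      push_cast; ring
    have e1 := e 10
    have e2 := e 20
    have e3 := e 6
    have e4 := e 12
    have e5 := e 18
    have e6 := e 24
    rw [Nat.cast_ofNat] at e1 e2 e3 e4 e5 e6
    rw [e1, e2, e3, e4, e5, e6]
    simp only [edge_succ, add_assoc, Nat.reduceAdd]
    refine and_congr ⟨fun h => ?_, fun h => ?_⟩ ⟨fun h => ?_, fun h => ?_⟩ <;>
      linear_combination h
  have cs : IsCentrallySymmetric (h := 30) 15 p ↔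
      ∀ k : ℕ, p (k : ℕ) + p (k + 15 : ℕ) = p (0 : ℕ) + p (15 : ℕ) := by
    constructor
    · rintro ⟨O, hO⟩ k
      have h1 := hO k
      have h2 := hO (0 : ℕ)
      rw [← sub_eq_zero] at h1 h2 ⊢
      push_cast at h1 h2 ⊢
      rw [zero_add] at h2
      linear_combination h1 - h2
    · refine fun h => ⟨(p (0 : ℕ) + p (15 : ℕ)) / 2, fun j => ?_⟩
      obtain ⟨k, rfl⟩ := exists_eq_natCast_succ (h := 30) j
      have h1 := h (k + 1)
      push_cast at h1 ⊢
      linear_combination h1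
  refine ⟨fun h k => ⟨cs.1 h.1 k, (key k).1 (h.2 _)⟩, fun h => ⟨cs.2 fun k => (h k).1, fun j => ?_⟩⟩
  obtain ⟨k, rfl⟩ := exists_eq_natCast_succ (h := 30) j
  exact (key k).2 (h k).2

theorem typeRelations_iff (t : ExcType) (p : ZMod t.coxeter → ℂ) :
    TypeRelations t p ↔ ∀ k : ℕ, polyRel t (fun k => p (k : ZMod t.coxeter)) k := by
  cases t with
  | E6 => exact typeRelations_iff_E6 p
  | E7 => exact typeRelations_iff_E7 p
  | E8 => exact typeRelations_iff_E8 p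

theorem innerRel_iff_E6 (p : ZMod 12 → ℂ) (w : ℂ) (k : ℕ) :
    innerRel .E6 (fun k => p (k : ZMod 12)) w k ↔ innerPoint .E6 p (k : ZMod 12) = w := by
  have e : (k : ZMod 12) + 4 = ((k + 3 + 1 : ℕ) : ZMod 12) := by push_cast; ring
  change _ ↔ p k + edge p ((k : ZMod 12) + 4) = w
  rw [e, edge_succ]
  simp only [innerRel, add_assoc, Nat.reduceAdd]
  constructor <;> intro h <;> linear_combination -h

theorem innerRel_iff_E7 (p : ZMod 18 → ℂ) (w : ℂ) (k : ℕ) :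
    innerRel .E7 (fun k => p (k : ZMod 18)) w k ↔ innerPoint .E7 p (k : ZMod 18) = w := by
  have e : (k : ZMod 18) + 5 = ((k + 4 + 1 : ℕ) : ZMod 18) := by push_cast; ring
  change _ ↔ p k + edge p ((k : ZMod 18) + 5) = w
  rw [e, edge_succ]
  simp only [innerRel, add_assoc, Nat.reduceAdd]
  constructor <;> intro h <;> linear_combination -h

theorem innerRel_iff_E8 (p : ZMod 30 → ℂ) (w : ℂ) (k : ℕ) :
    innerRel .E8 (fun k => p (k : ZMod 30)) w k ↔ innerPoint .E8 p (k : ZMod 30) = w := by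
  have e : (k : ZMod 30) + 11 = ((k + 10 + 1 : ℕ) : ZMod 30) := by push_cast; ring
  have e' : (k : ZMod 30) + 1 = ((k + 1 : ℕ) : ZMod 30) := by push_cast; ring
  change _ ↔ p ((k : ZMod 30) + 1) + edge p ((k : ZMod 30) + 11) = w
  rw [e, edge_succ, e']
  simp only [innerRel, add_assoc, Nat.reduceAdd]
  constructor <;> intro h <;> linear_combination -h

theorem innerRel_iff (t : ExcType) (p : ZMod t.coxeter → ℂ) (w : ℂ) (k : ℕ) :
    innerRel t (fun k => p (k : ZMod t.coxeter)) w k ↔ innerPoint t p k = w := by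
  cases t with
  | E6 => exact innerRel_iff_E6 p w k
  | E7 => exact innerRel_iff_E7 p w k
  | E8 => exact innerRel_iff_E8 p w k

/-! ### Numerical codes of labels -/

/-- The labels `V_0, …, V_{h-1}, W_0, …, W_{h-1}` have the codes `0, …, 2 h - 1`. -/
def code {t : ExcType} : Label t → ℕ
  | .V j => j.val
  | .W j => t.coxeter + j.val

def lab (t : ExcType) (c : ℕ) : Label t := if c < t.coxeter then .V c else .W c

theorem lab_code {t : ExcType} (P : Label t) : lab t (code P) = P := by
  cases P with
  | V j => simp [lab, code, ZMod.val_lt]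
  | W j => simp [lab, code]

theorem code_lab {t : ExcType} {c : ℕ} (hc : c < 2 * t.coxeter) : code (lab t c) = c := by
  unfold lab
  split_ifs with h
  · simp [code, ZMod.val_natCast, Nat.mod_eq_of_lt h]
  · have : c % t.coxeter = c - t.coxeter := by
      rw [Nat.mod_eq_sub_mod (by omega), Nat.mod_eq_of_lt (by omega)]
    simp only [code, ZMod.val_natCast, this]
    omega

theorem code_lt {t : ExcType} (P : Label t) : code P < 2 * t.coxeter := by
  cases P with
  | V j => have := ZMod.val_lt j; simp only [code]; omega
  | W j => have := ZMod.val_lt j; simp only [code]; omega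

theorem code_injective {t : ExcType} : Function.Injective (code (t := t)) :=
  Function.LeftInverse.injective lab_code

theorem lab_of_lt {t : ExcType} {c : ℕ} (hc : c < t.coxeter) : lab t c = .V c := by simp [lab, hc]

theorem lab_coxeter_add (t : ExcType) (c : ℕ) : lab t (t.coxeter + c) = .W c := by simp [lab]

theorem lab_mod (t : ExcType) (c : ℕ) : lab t (c % t.coxeter) = .V c := by
  rw [lab_of_lt (Nat.mod_lt _ (NeZero.pos _))]; simp

/-- The points of an `h`-gon satisfy the relations. -/
theorem HGon.seqRel {t : ExcType} (G : HGon t) : SeqRel t (fun c => G.pt (lab t c)) := by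
  have hv : vtx t (fun c => G.pt (lab t c)) = fun k : ℕ => G.vertex (k : ZMod t.coxeter) := by
    funext k
    simp [vtx, lab_mod, HGon.pt]
  intro k
  refine ⟨?_, ?_⟩
  · rw [hv]; exact (typeRelations_iff t G.vertex).1 G.relations k
  · rw [hv, innerRel_iff]
    simp [inn, lab_coxeter_add, HGon.pt]

theorem vtx_code {t : ExcType} (g : ℕ → ℂ) :
    (fun k : ℕ => g (k : ZMod t.coxeter).val) = vtx t g := by
  funext k
  simp [vtx, ZMod.val_natCast]

/-- The `h`-gon with given points, subject to the relations. -/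
def gonOf (t : ExcType) (g : ℕ → ℂ) (hg : SeqRel t g) (hne : ∀ k, vtx t g (k + 1) ≠ vtx t g k) :
    HGon t where
  vertex j := g j.val
  edge_ne_zero j := by
    obtain ⟨k, rfl⟩ := exists_eq_natCast_succ j
    rw [edge_succ, sub_ne_zero]
    simpa [vtx, ZMod.val_natCast, ← Nat.cast_succ, -Nat.cast_add] using hne k
  relations := by
    rw [typeRelations_iff, vtx_code]
    exact fun k => (hg k).1

theorem pt_gonOf (t : ExcType) (g : ℕ → ℂ) (hg : SeqRel t g)
    (hne : ∀ k, vtx t g (k + 1) ≠ vtx t g k) (P : Label t) :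
    (gonOf t g hg hne).pt P = g (code P) := by
  cases P with
  | V j => rfl
  | W j =>
    have h := (hg j.val).2
    rw [← vtx_code g] at h
    have h := (innerRel_iff t (fun j : ZMod t.coxeter => g j.val) _ _).1 h
    simpa [HGon.pt, gonOf, inn, code, Nat.mod_eq_of_lt (ZMod.val_lt j)] using h

/-! ### The root lattice -/

/-- The coordinates of the points `V_0, …, V_{h-1}, W_0, …, W_{h-1}` in the root lattice, with
respect to a basis of simple roots in Bourbaki order. -/
def rootTable : ExcType → List (List ℤ)
  | .E6 =>
    [[0, 0, 0, 1, 1, 1], [0, 0, 0, 0, 1, 1], [0, 0, 0, 0, 0, 1], [0, 0, 0, 0, 0, 0],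
    [1, 1, 1, 1, 1, 1], [1, 1, 2, 2, 1, 1], [1, 2, 2, 3, 2, 1], [2, 2, 3, 4, 3, 2],
    [1, 2, 3, 4, 3, 2], [1, 2, 2, 4, 3, 2], [1, 1, 2, 3, 3, 2], [0, 1, 1, 2, 2, 2],
    [1, 1, 1, 2, 2, 2], [0, 0, 1, 1, 1, 1], [0, 1, 0, 1, 1, 1], [1, 0, 1, 1, 1, 1],
    [0, 1, 1, 1, 1, 1], [1, 1, 1, 2, 1, 1], [1, 1, 2, 2, 2, 1], [1, 2, 2, 3, 2, 2],
    [1, 1, 2, 3, 2, 1], [1, 2, 2, 3, 3, 2], [1, 1, 2, 3, 2, 2], [0, 1, 1, 2, 2, 1]]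
  | .E7 =>
    [[0, 0, 0, 1, 1, 1, 1], [0, 0, 0, 0, 1, 1, 1], [0, 0, 0, 0, 0, 1, 1], [0, 0, 0, 0, 0, 0, 1],
    [0, 0, 0, 0, 0, 0, 0], [1, 1, 1, 1, 1, 1, 1], [1, 1, 2, 2, 1, 1, 1], [1, 2, 2, 3, 2, 1, 1],
    [2, 2, 3, 4, 3, 2, 1], [2, 3, 4, 5, 4, 3, 2], [2, 3, 4, 6, 4, 3, 2], [2, 3, 4, 6, 5, 3, 2],
    [2, 3, 4, 6, 5, 4, 2], [2, 3, 4, 6, 5, 4, 3], [1, 2, 3, 5, 4, 3, 2], [1, 2, 2, 4, 4, 3, 2],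
    [1, 1, 2, 3, 3, 3, 2], [0, 1, 1, 2, 2, 2, 2], [1, 1, 1, 2, 2, 2, 2], [0, 0, 1, 1, 1, 1, 1],
    [0, 1, 0, 1, 1, 1, 1], [1, 0, 1, 1, 1, 1, 1], [0, 1, 1, 1, 1, 1, 1], [1, 1, 1, 2, 1, 1, 1],
    [1, 1, 2, 2, 2, 1, 1], [1, 2, 2, 3, 2, 2, 1], [2, 2, 3, 4, 3, 2, 2], [1, 2, 3, 4, 3, 2, 1],
    [2, 3, 3, 5, 4, 3, 2], [2, 2, 4, 5, 4, 3, 2], [1, 3, 3, 5, 4, 3, 2], [2, 2, 3, 5, 4, 3, 2],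
    [1, 2, 3, 4, 4, 3, 2], [1, 2, 2, 4, 3, 3, 2], [1, 1, 2, 3, 3, 2, 2], [0, 1, 1, 2, 2, 2, 1]]
  | .E8 =>
    [[0, 0, 0, 1, 1, 1, 1, 1], [0, 0, 0, 0, 1, 1, 1, 1], [0, 0, 0, 0, 0, 1, 1, 1],
    [0, 0, 0, 0, 0, 0, 1, 1], [0, 0, 0, 0, 0, 0, 0, 1], [0, 0, 0, 0, 0, 0, 0, 0],
    [1, 1, 1, 1, 1, 1, 1, 1], [1, 1, 2, 2, 1, 1, 1, 1], [1, 2, 2, 3, 2, 1, 1, 1],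
    [2, 2, 3, 4, 3, 2, 1, 1], [2, 3, 4, 5, 4, 3, 2, 1], [3, 4, 5, 7, 5, 4, 3, 2],
    [3, 4, 6, 8, 6, 4, 3, 2], [3, 5, 6, 9, 7, 5, 3, 2], [4, 5, 7, 10, 8, 6, 4, 2],
    [4, 6, 8, 11, 9, 7, 5, 3], [4, 6, 8, 12, 9, 7, 5, 3], [4, 6, 8, 12, 10, 7, 5, 3],
    [4, 6, 8, 12, 10, 8, 5, 3], [4, 6, 8, 12, 10, 8, 6, 3], [4, 6, 8, 12, 10, 8, 6, 4],
    [3, 5, 7, 11, 9, 7, 5, 3], [3, 5, 6, 10, 9, 7, 5, 3], [3, 4, 6, 9, 8, 7, 5, 3],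
    [2, 4, 5, 8, 7, 6, 5, 3], [2, 3, 4, 7, 6, 5, 4, 3], [1, 2, 3, 5, 5, 4, 3, 2],
    [1, 2, 2, 4, 4, 4, 3, 2], [1, 1, 2, 3, 3, 3, 3, 2], [0, 1, 1, 2, 2, 2, 2, 2],
    [1, 1, 1, 2, 2, 2, 2, 2], [0, 0, 1, 1, 1, 1, 1, 1], [0, 1, 0, 1, 1, 1, 1, 1],
    [1, 0, 1, 1, 1, 1, 1, 1], [0, 1, 1, 1, 1, 1, 1, 1], [1, 1, 1, 2, 1, 1, 1, 1],
    [1, 1, 2, 2, 2, 1, 1, 1], [1, 2, 2, 3, 2, 2, 1, 1], [2, 2, 3, 4, 3, 2, 2, 1],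
    [2, 3, 4, 5, 4, 3, 2, 2], [2, 3, 4, 6, 4, 3, 2, 1], [3, 4, 5, 7, 6, 4, 3, 2],
    [3, 4, 6, 8, 6, 5, 3, 2], [3, 5, 6, 9, 7, 5, 4, 2], [4, 5, 7, 10, 8, 6, 4, 3],
    [3, 5, 7, 10, 8, 6, 4, 2], [4, 6, 7, 11, 9, 7, 5, 3], [4, 5, 8, 11, 9, 7, 5, 3],
    [3, 6, 7, 11, 9, 7, 5, 3], [4, 5, 7, 11, 9, 7, 5, 3], [3, 5, 7, 10, 9, 7, 5, 3],
    [3, 5, 6, 10, 8, 7, 5, 3], [3, 4, 6, 9, 8, 6, 5, 3], [2, 4, 5, 8, 7, 6, 4, 3],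
    [2, 3, 4, 7, 6, 5, 4, 2], [2, 3, 4, 6, 6, 5, 4, 3], [1, 2, 3, 5, 4, 4, 3, 2],
    [1, 2, 2, 4, 4, 3, 3, 2], [1, 1, 2, 3, 3, 3, 2, 2], [0, 1, 1, 2, 2, 2, 2, 1]]

/-- The root lattice is seen in the one of type `E₈`. -/
def root (t : ExcType) (c : ℕ) : Fin 8 → ℤ := fun i => ((rootTable t).getD c []).getD i 0

/-- The symmetric bilinear form of type `E₈`. -/
def form (x y : Fin 8 → ℤ) : ℤ :=
  2 * (x 0 * y 0 + x 1 * y 1 + x 2 * y 2 + x 3 * y 3 + x 4 * y 4 + x 5 * y 5 + x 6 * y 6 + x 7 * y 7)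
    - (x 0 * y 2 + x 2 * y 0) - (x 1 * y 3 + x 3 * y 1) - (x 2 * y 3 + x 3 * y 2)
    - (x 3 * y 4 + x 4 * y 3) - (x 4 * y 5 + x 5 * y 4) - (x 5 * y 6 + x 6 * y 5)
    - (x 6 * y 7 + x 7 * y 6)

theorem form_sub_self (x y : Fin 8 → ℤ) :
    form (x - y) (x - y) = form x x - 2 * form x y + form y y := by
  simp only [form, Pi.sub_apply]; ring

theorem form_neg_left (x y : Fin 8 → ℤ) : form (-x) y = -form x y := by
  simp only [form, Pi.neg_apply]; ring

theorem form_neg_right (x y : Fin 8 → ℤ) : form x (-y) = -form x y := by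
  simp only [form, Pi.neg_apply]; ring

/-- The table is itself a polygon of the given type, with values in the lattice: the universal one.
-/
theorem seqRel_root (t : ExcType) : SeqRel t (root t) := by
  refine SeqRel.of_lt ?_
  cases t <;> decide +kernel

/-- The complex number with given values at the simple roots. -/
noncomputable def charge (Z : Fin 8 → ℂ) : (Fin 8 → ℤ) →+ ℂ where
  toFun x := ∑ i, (x i : ℂ) * Z i
  map_zero' := by simp
  map_add' x y := by simp [add_mul, Finset.sum_add_distrib]

theorem charge_apply (Z : Fin 8 → ℂ) (x : Fin 8 → ℤ) : charge Z x = ∑ i, (x i : ℂ) * Z i := rfl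

/-! ### Recursion for the edges, and central charges -/

/-- The edge `V_k V_{k+1}`. -/
def step (t : ExcType) {A : Type*} [AddCommGroup A] (g : ℕ → A) (k : ℕ) : A :=
  vtx t g (k + 1) - vtx t g k

theorem vtx_add_coxeter (t : ExcType) {A : Type*} (g : ℕ → A) (k : ℕ) :
    vtx t g (k + t.coxeter) = vtx t g k := by
  simp [vtx]

/-- The linear recursion that the edges satisfy. -/
theorem SeqRel.step_eq_zero {t : ExcType} {g : ℕ → ℂ} (hg : SeqRel t g)
    (h0 : ∀ k < t.rank, step t g k = 0) (k : ℕ) : step t g k = 0 := by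
  induction k using Nat.strong_induction_on with
  | _ k ih =>
    obtain hk | hk := lt_or_ge k t.rank
    · exact h0 k hk
    obtain ⟨k, rfl⟩ := Nat.exists_eq_add_of_le' hk
    have hd := fun m (hm : m < t.rank) => ih (k + m) (by omega)
    have hp := fun k => (hg k).1
    have hper := vtx_add_coxeter t g
    unfold step at hd ⊢
    cases t with
    | E6 =>
      simp only [polyRel, ExcType.rank, ExcType.coxeter] at *
      have r1 := (hp (k + 1)).1
      have r2 := (hp k).2
      have d0 := hd 0 (by decide)
      have d1 := hd 1 (by decide)
      have d3 := hd 3 (by decide)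
      have d5 := hd 5 (by decide)
      simp only [add_assoc, Nat.reduceAdd, add_zero] at *
      -- The recursion has the Coxeter polynomial `x^6 + x^5 - x^3 + x + 1 = Φ₃ Φ₁₂`.
      linear_combination r1 + r2 - d5 + d3 - d1 - d0
    | E7 =>
      simp only [polyRel, ExcType.rank, ExcType.coxeter] at *
      have r1 := (hp (k + 1)).2
      have r0 := (hp k).2
      have c1 := (hp (k + 3)).1
      have c2 := (hp (k + 4)).1
      have c3 := (hp (k + 5)).1
      have d0 := hd 0 (by decide)
      have d1 := hd 1 (by decide)
      have d3 := hd 3 (by decide)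
      have d4 := hd 4 (by decide)
      have d6 := hd 6 (by decide)
      simp only [add_assoc, Nat.reduceAdd, add_zero] at *
      -- Here the Coxeter polynomial is `x^7 + x^6 - x^4 - x^3 + x + 1 = Φ₂ Φ₁₈`.
      linear_combination r0 + c1 - c3 - d6 + d4 + d3 - d1 - d0
    | E8 =>
      simp only [polyRel, ExcType.rank, ExcType.coxeter] at *
      have f0 := (hp k).2.1
      have f3 := (hp (k + 3)).2.1
      have g1 := (hp (k + 1)).2.2
      have c (m : ℕ) := (hp (k + m)).1
      have c4 := c 4
      have c5 := c 5
      have c6 := c 6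
      have c8 := c 8
      have c9 := c 9
      have c10 := c 10
      have c11 := c 11
      have d0 := hd 0 (by decide)
      have d1 := hd 1 (by decide)
      have d3 := hd 3 (by decide)
      have d4 := hd 4 (by decide)
      have d5 := hd 5 (by decide)
      have d7 := hd 7 (by decide)
      simp only [add_assoc, Nat.reduceAdd, add_zero] at *
      -- Here the Coxeter polynomial is `x^8 + x^7 - x^5 - x^4 - x^3 + x + 1 = Φ₃₀`.
      linear_combination (f0 - c6 + c5) - (f3 - c9 + c8) + (g1 - c5 + c4 - c11 + c10)
        - d7 + d5 + d4 + d3 - d1 - d0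

/-- This is the uniqueness behind `SeqRel.exists_charge`, applied to the difference of two
solutions: inner points are fixed by the vertices, and the vertices by the edges. -/
theorem SeqRel.eq_of_step_eq_zero {t : ExcType} {g : ℕ → ℂ} (hg : SeqRel t g)
    (h0 : ∀ k < t.rank, step t g k = 0) {c : ℕ} (hc : c < 2 * t.coxeter) : g c = g 0 := by
  have hs := hg.step_eq_zero h0
  have hv : ∀ k, vtx t g k = g 0 := by
    intro k
    induction k with
    | zero => simp [vtx]
    | succ k ih => rw [← ih]; exact sub_eq_zero.1 (hs k)
  have hi : ∀ k, inn t g k = g 0 := by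
    intro k
    have h := (hg k).2
    cases t <;> simp only [innerRel, hv] at h <;> linear_combination h
  obtain h | h := lt_or_ge c t.coxeter
  · simpa [vtx, Nat.mod_eq_of_lt h] using hv c
  · have := hi (c - t.coxeter)
    rwa [inn, Nat.mod_eq_of_lt (by omega), Nat.add_sub_cancel' h] at this

theorem SeqRel.sub {t : ExcType} {g g' : ℕ → ℂ} (h : SeqRel t g) (h' : SeqRel t g') :
    SeqRel t (fun c => g c - g' c) := by
  intro k
  have h := h k
  have h' := h' k
  cases t with
  | E6 =>
    simp only [SeqRelAt, polyRel, innerRel, vtx, inn] at h h' ⊢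
    exact ⟨⟨by linear_combination h.1.1 - h'.1.1, by linear_combination h.1.2 - h'.1.2⟩,
      by linear_combination h.2 - h'.2⟩
  | E7 =>
    simp only [SeqRelAt, polyRel, innerRel, vtx, inn] at h h' ⊢
    exact ⟨⟨by linear_combination h.1.1 - h'.1.1, by linear_combination h.1.2 - h'.1.2⟩,
      by linear_combination h.2 - h'.2⟩
  | E8 =>
    simp only [SeqRelAt, polyRel, innerRel, vtx, inn] at h h' ⊢
    exact ⟨⟨by linear_combination h.1.1 - h'.1.1, by linear_combination h.1.2.1 - h'.1.2.1,
      by linear_combination h.1.2.2 - h'.1.2.2⟩, by linear_combination h.2 - h'.2⟩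

/-- The simple roots as combinations of the edges `V_0 V_1, …, V_{n-1} V_n`. -/
def simpleTable : ExcType → List (List ℤ)
  | .E6 =>
    [[-1, 0, 1, 1, -1, -1], [1, 1, 0, 0, 0, 1], [1, 0, 0, 0, 1, 0], [-1], [0, -1], [0, 0, -1]]
  | .E7 =>
    [[-1, 0, 1, 1, 1, -1, -1], [1, 1, 0, 0, 0, 0, 1], [1, 0, 0, 0, 0, 1], [-1], [0, -1], [0, 0, -1],
      [0, 0, 0, -1]]
  | .E8 =>
    [[-1, 0, 1, 1, 1, 1, -1, -1], [1, 1, 0, 0, 0, 0, 0, 1], [1, 0, 0, 0, 0, 0, 1], [-1], [0, -1],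
      [0, 0, -1], [0, 0, 0, -1], [0, 0, 0, 0, -1]]

def simpleCoeff (t : ExcType) (i k : ℕ) : ℤ := ((simpleTable t).getD i []).getD k 0

/-- The first `n` edges form a basis of the root lattice, so a charge can be prescribed on them. -/
theorem simpleCoeff_inverse (t : ExcType) : ∀ k < t.rank, ∀ l < t.rank,
    ∑ i : Fin 8, step t (root t) k i * simpleCoeff t i l = if l = k then 1 else 0 := by
  cases t <;> decide +kernel

/-- Every `h`-gon is obtained, up to a translation, from a central charge. -/
theorem SeqRel.exists_charge {t : ExcType} {g : ℕ → ℂ} (hg : SeqRel t g) :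
    ∃ Z, ∀ c < 2 * t.coxeter, g c - charge Z (root t c) = g 0 - charge Z (root t 0) := by
  -- With this choice `charge Z` takes the value `step t g k` at the lattice edge `step t (root t)
  -- k` for every `k < n`.
  let Z : Fin 8 → ℂ := fun i => ∑ l ∈ Finset.range t.rank, (simpleCoeff t i l : ℂ) * step t g l
  refine ⟨Z, fun c hc => ?_⟩
  refine (hg.sub ((seqRel_root t).map (charge Z))).eq_of_step_eq_zero (fun k hk => ?_) hc
  have h1 : step t (fun c => g c - charge Z (root t c)) k
      = step t g k - charge Z (step t (root t) k) := by
    rw [step, step, step, map_sub]; simp only [vtx]; ring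
  have h2 : charge Z (step t (root t) k) = ∑ l ∈ Finset.range t.rank,
      ((∑ i : Fin 8, step t (root t) k i * simpleCoeff t i l : ℤ) : ℂ) * step t g l := by
    simp only [charge_apply, Z, Finset.mul_sum, Int.cast_sum, Int.cast_mul, Finset.sum_mul]
    rw [Finset.sum_comm]
    simp only [mul_assoc]
  rw [h1, h2, Finset.sum_congr rfl fun l hl => by
    rw [simpleCoeff_inverse t k hk l (Finset.mem_range.1 hl)]]
  simp [hk]

theorem step_root_ne_zero (t : ExcType) : ∀ k < t.coxeter, step t (root t) k ≠ 0 := by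
  cases t <;> decide +kernel

/-- A non-zero lattice vector does not vanish in some `h`-gon. -/
theorem exists_gon_charge_ne_zero (t : ExcType) {x : Fin 8 → ℤ} (hx : x ≠ 0) :
    ∃ (G : HGon t) (Z : Fin 8 → ℂ), (∀ P, G.pt P = charge Z (root t (code P))) ∧
      charge Z x ≠ 0 := by
  -- For fixed `y` the charge of `y` is a linear functional of `Z`. Finitely many non-zero
  -- functionals, here those of `x` and of the `h` edges, are simultaneously non-zero at some `Z`;
  -- the edges are included because a polygon needs non-zero edges.
  let φ (y : Fin 8 → ℤ) : Module.Dual ℂ (Fin 8 → ℂ) := ∑ i, (y i : ℂ) • LinearMap.proj i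
  have hφ (y : Fin 8 → ℤ) (Z : Fin 8 → ℂ) : φ y Z = charge Z y := by simp [φ, charge_apply]
  have hφ0 (y : Fin 8 → ℤ) (hy : y ≠ 0) : ∃ Z, φ y Z ≠ 0 := by
    obtain ⟨i, hi⟩ := Function.ne_iff.1 hy
    refine ⟨Pi.single i 1, ?_⟩
    simpa [hφ, charge_apply, Pi.single_apply] using hi
  obtain ⟨Z, hZ⟩ := Module.Dual.exists_forall_ne_zero_of_forall_exists
    (fun o : Option (Fin t.coxeter) => φ (o.elim x fun k => step t (root t) k))
    (by
      rintro (_ | k)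
      · exact hφ0 _ hx
      · exact hφ0 _ (step_root_ne_zero t k k.2))
  refine ⟨gonOf t _ ((seqRel_root t).map (charge Z)) fun k => ?_, Z, fun P => pt_gonOf _ _ _ _ P, ?_⟩
  · have := hZ (some ⟨k % t.coxeter, Nat.mod_lt _ (NeZero.pos _)⟩)
    rw [hφ, Option.elim_some, step, map_sub, sub_ne_zero] at this
    have h0 := vtx_mod_add t (root t) k 0
    rw [add_zero, add_zero] at h0
    rwa [vtx_mod_add, h0] at this
  · have := hZ none
    rwa [hφ] at this

/-! ### Diagonals as lattice vectors -/

/-- The vector of the root lattice from `P` to `Q`. -/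
def rvec {t : ExcType} (P Q : Label t) : Fin 8 → ℤ := root t (code Q) - root t (code P)

theorem rvec_swap {t : ExcType} (P Q : Label t) : rvec Q P = -rvec P Q := by simp [rvec]

theorem HGon.exists_charge {t : ExcType} (G : HGon t) :
    ∃ Z, ∀ P Q, G.pt Q - G.pt P = charge Z (rvec P Q) := by
  obtain ⟨Z, hZ⟩ := G.seqRel.exists_charge
  refine ⟨Z, fun P Q => ?_⟩
  have h1 := hZ _ (code_lt P)
  have h2 := hZ _ (code_lt Q)
  rw [lab_code] at h1 h2
  rw [rvec, map_sub]
  linear_combination h2 - h1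

/-- Every polygon factors through a charge, which gives one direction. For the other, a non-zero
difference of lattice vectors is seen by some polygon. -/
theorem Diag.mk_eq_mk_iff {t : ExcType} {P Q P' Q' : Label t} :
    Diag.mk P Q = Diag.mk P' Q' ↔ rvec P Q = rvec P' Q' := by
  refine (Quotient.eq (r := diagSetoid t)).trans ?_
  change (∀ G : HGon t, G.pt Q - G.pt P = G.pt Q' - G.pt P') ↔ _
  constructor
  · intro h
    by_contra hne
    obtain ⟨G, Z, hG, hZ⟩ := exists_gon_charge_ne_zero t (sub_ne_zero.2 hne)
    apply hZ
    have := h G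
    simp only [hG] at this
    simp only [rvec, map_sub]
    linear_combination this
  · intro h G
    obtain ⟨Z, hZ⟩ := G.exists_charge
    rw [hZ, hZ, h]

/-! ### Admissible diagonals -/

/-- Diagonals are listed by their starting point, so `V_{j-1} W_{j+2}` and `V_{j-1} W_{j+1}` appear
with `k = j - 1` and shifts `3` and `2`. -/
def basicCodes (t : ExcType) : List (ℕ × ℕ) :=
  (List.range t.coxeter).flatMap fun k =>
    (t.coxeter + k, t.coxeter + (k + 2) % t.coxeter) ::
    (k, t.coxeter + (k + 3) % t.coxeter) ::
    (k, t.coxeter + (k + 2) % t.coxeter) ::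
    (List.range' 1 (t.rank - 3)).map fun s => (k, (k + s) % t.coxeter)

theorem mem_basicCodes {t : ExcType} {x y : ℕ} : (x, y) ∈ basicCodes t ↔ ∃ k < t.coxeter,
    (x = t.coxeter + k ∧ y = t.coxeter + (k + 2) % t.coxeter) ∨
    (x = k ∧ y = t.coxeter + (k + 3) % t.coxeter) ∨
    (x = k ∧ y = t.coxeter + (k + 2) % t.coxeter) ∨
    ∃ s, (1 ≤ s ∧ s ≤ t.rank - 3) ∧ x = k ∧ y = (k + s) % t.coxeter := by
  have hs (s : ℕ) : (1 ≤ s ∧ s < 1 + (t.rank - 3)) ↔ 1 ≤ s ∧ s ≤ t.rank - 3 := by omega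
  simp only [basicCodes, List.mem_flatMap, List.mem_range, List.mem_cons, Prod.mk.injEq,
    List.mem_map, List.mem_range'_1, hs, eq_comm (a := x), eq_comm (a := y)]

theorem isBasicDiag_of_mem {t : ExcType} {x y : ℕ} (h : (x, y) ∈ basicCodes t) :
    IsBasicDiag (lab t x) (lab t y) := by
  obtain ⟨k, hk, ⟨rfl, rfl⟩ | ⟨rfl, rfl⟩ | ⟨rfl, rfl⟩ | ⟨s, ⟨h1, h2⟩, rfl, rfl⟩⟩ :=
    mem_basicCodes.1 h
  · have := IsBasicDiag.WW (t := t) (k : ZMod t.coxeter)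
    simpa [lab_coxeter_add] using this
  · have := IsBasicDiag.VW2 (t := t) ((x + 1 : ℕ) : ZMod t.coxeter)
    rw [lab_coxeter_add, lab_of_lt hk, ZMod.natCast_mod]
    convert this using 2 <;> (push_cast; ring)
  · have := IsBasicDiag.VW1 (t := t) ((x + 1 : ℕ) : ZMod t.coxeter)
    rw [lab_coxeter_add, lab_of_lt hk, ZMod.natCast_mod]
    convert this using 2 <;> (push_cast; ring)
  · have := IsBasicDiag.VV (t := t) (x : ZMod t.coxeter) s h1 h2
    rw [lab_mod, lab_of_lt hk]
    simpa using this

theorem mem_basicCodes_of {t : ExcType} {P Q : Label t} (h : IsBasicDiag P Q) :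
    (code P, code Q) ∈ basicCodes t := by
  rw [mem_basicCodes]
  cases h with
  | VV j s h1 h2 =>
    refine ⟨j.val, ZMod.val_lt j, .inr (.inr (.inr ⟨s, ⟨h1, h2⟩, rfl, ?_⟩))⟩
    simp only [code, ZMod.val_add, ZMod.val_natCast, Nat.add_mod_mod]
  | WW j =>
    refine ⟨j.val, ZMod.val_lt j, .inl ⟨rfl, ?_⟩⟩
    have : j + 2 = j + (2 : ℕ) := by simp
    rw [this]
    simp only [code, ZMod.val_add, ZMod.val_natCast, Nat.add_mod_mod]
  | VW2 j =>
    refine ⟨(j - 1).val, ZMod.val_lt _, .inr (.inl ⟨rfl, ?_⟩)⟩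
    have : j + 2 = j - 1 + (3 : ℕ) := by push_cast; ring
    rw [this]
    simp only [code, ZMod.val_add, ZMod.val_natCast, Nat.add_mod_mod]
  | VW1 j =>
    refine ⟨(j - 1).val, ZMod.val_lt _, .inr (.inr (.inl ⟨rfl, ?_⟩))⟩
    have : j + 1 = j - 1 + (2 : ℕ) := by push_cast; ring
    rw [this]
    simp only [code, ZMod.val_add, ZMod.val_natCast, Nat.add_mod_mod]

theorem form_basic (t : ExcType) : ∀ p ∈ basicCodes t,
    form (root t p.2 - root t p.1) (root t p.2 - root t p.1) = 2 := by
  cases t <;> decide +kernel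

/-- Admissible diagonals are roots. -/
theorem Diag.Admissible.form_eq {t : ExcType} {X Y : Label t} (h : (Diag.mk X Y).Admissible) :
    form (rvec X Y) (rvec X Y) = 2 := by
  obtain ⟨P, Q, hb, h⟩ := h
  have h2 : form (rvec P Q) (rvec P Q) = 2 := form_basic t (code P, code Q) (mem_basicCodes_of hb)
  obtain h | h := h
  · rw [Diag.mk_eq_mk_iff.1 h, h2]
  · rw [Diag.mk_eq_mk_iff.1 h, rvec_swap, form_neg_left, form_neg_right, neg_neg, h2]

/-- The codes of the labels `V_0, …, V_{n-2}, W_1, …, W_4`. -/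
def localCodes (t : ExcType) : List ℕ :=
  List.range (t.rank - 1) ++ List.range' (t.coxeter + 1) 4

/-- A converse of `form_basic` near the bottom of the polygon. These labels contain both candidate
triangles and all endpoints that are needed, so there admissibility can be read off from the form.
-/
theorem exists_basic_of_form (t : ExcType) : ∀ x ∈ localCodes t, ∀ y ∈ localCodes t,
    form (root t y - root t x) (root t y - root t x) = 2 → ∃ p ∈ basicCodes t,
      root t y - root t x = root t p.2 - root t p.1 ∨
        root t y - root t x = root t p.1 - root t p.2 := by
  cases t <;> decide +kernel

theorem lt_of_mem_localCodes {t : ExcType} {x : ℕ} (h : x ∈ localCodes t) :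
    x < 2 * t.coxeter := by
  revert x
  cases t <;> decide

theorem lt_of_mem_basicCodes {t : ExcType} {p : ℕ × ℕ} (h : p ∈ basicCodes t) :
    p.1 < 2 * t.coxeter ∧ p.2 < 2 * t.coxeter := by
  have hm (m : ℕ) : m % t.coxeter < t.coxeter := Nat.mod_lt _ (NeZero.pos _)
  obtain ⟨x, y⟩ := p
  obtain ⟨k, hk, h⟩ := mem_basicCodes.1 h
  have h1 := hm (k + 2)
  have h2 := hm (k + 3)
  obtain h | h | h | ⟨s, -, h⟩ := h
  · dsimp only; omega
  · dsimp only; omega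
  · dsimp only; omega
  · have h3 := hm (k + s)
    dsimp only
    omega

theorem admissible_of_form {t : ExcType} {x y : ℕ} (hx : x ∈ localCodes t) (hy : y ∈ localCodes t)
    (h : form (root t y - root t x) (root t y - root t x) = 2) :
    (Diag.mk (lab t x) (lab t y)).Admissible := by
  obtain ⟨⟨p, q⟩, hpq, h⟩ := exists_basic_of_form t x hx y hy h
  obtain ⟨hp, hq⟩ := lt_of_mem_basicCodes hpq
  refine ⟨_, _, isBasicDiag_of_mem hpq, ?_⟩
  simpa [Diag.mk_eq_mk_iff, rvec, code_lab (lt_of_mem_localCodes hx),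
    code_lab (lt_of_mem_localCodes hy), code_lab hp, code_lab hq] using h

/-! ### Polygons with natural coordinates -/

/-- The complex number with given natural coordinates. -/
def natPt : ℕ × ℕ →+ ℂ where
  toFun a := ⟨a.1, a.2⟩
  map_zero' := by apply Complex.ext <;> simp
  map_add' a b := by apply Complex.ext <;> simp

theorem natPt_re (a : ℕ × ℕ) : (natPt a).re = a.1 := rfl
theorem natPt_im (a : ℕ × ℕ) : (natPt a).im = a.2 := rfl

/-- The order of the plane. -/
def ltPt (a b : ℕ × ℕ) : Bool := Nat.blt a.2 b.2 || (Nat.beq a.2 b.2 && Nat.blt a.1 b.1)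

theorem ltPt_iff {a b : ℕ × ℕ} : ltPt a b = true ↔ PLt (natPt a) (natPt b) := by
  simp [ltPt, PLt, natPt_re, natPt_im, Nat.blt_eq, Nat.beq_eq]

/-- Whether the vector from `c` to `d` is on the left hand side of the vector from `a` to `b`. -/
def leftOf (a b c d : ℕ × ℕ) : Bool :=
  Nat.blt
    (((b.1.mul c.2).add (a.1.mul d.2)).add ((b.2.mul d.1).add (a.2.mul c.1)))
    (((b.1.mul d.2).add (a.1.mul c.2)).add ((b.2.mul c.1).add (a.2.mul d.1)))

theorem leftOf_iff {a b c d : ℕ × ℕ} :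
    leftOf a b c d = true ↔ 0 < cross (natPt b - natPt a) (natPt d - natPt c) := by
  rw [leftOf, Nat.blt_eq, ← @Nat.cast_lt ℝ]
  simp only [Nat.add_eq, Nat.mul_eq]
  simp only [cross, Complex.sub_re, Complex.sub_im, natPt_re, natPt_im]
  push_cast
  constructor <;> intro h <;> linarith

theorem PLt.trans {P Q R : ℂ} (h : PLt P Q) (h' : PLt Q R) : PLt P R := by
  unfold PLt at *
  rcases h with h | ⟨h1, h2⟩ <;> rcases h' with h' | ⟨h1', h2'⟩
  · left; linarith
  · left; linarith
  · left; linarith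
  · right; constructor <;> linarith

theorem PLt.irrefl (P : ℂ) : ¬ PLt P P := by simp [PLt]

theorem PLt.asymm {P Q : ℂ} (h : PLt P Q) : ¬ PLt Q P := fun h' => PLt.irrefl P (h.trans h')

theorem plt_iff_sub {P Q : ℂ} : PLt P Q ↔ PLt 0 (Q - P) := by
  simp [PLt, sub_eq_zero, eq_comm]

/-- A sequence of points with natural coordinates. -/
abbrev Pts := ℕ → ℕ × ℕ

/-- The edges of the Dynkin diagram are the pairs `dynkinEdge k`, `k < n - 1`. -/
def dynkinEdge : ℕ → ℕ × ℕ
  | 0 => (0, 2)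
  | 1 => (2, 3)
  | 2 => (1, 3)
  | k + 3 => (k + 3, k + 4)

/-- Intended for `i < j` only; `adjacent_iff` compares it with `dynkinEdge` in that range. -/
def adjacent (i j : ℕ) : Bool := if Nat.blt i 2 then j == i + 2 else j == i + 1

section

variable (t : ExcType) (g : Pts)

/-- The vertices of the lower one of the two triangles. -/
def triangleCodes : List ℕ :=
  if ltPt (g (t.coxeter + 1)) (g (t.coxeter + 4)) then [t.coxeter + 3, t.coxeter + 1, 0]
  else [t.rank - 2, t.coxeter + 4, t.coxeter + 2]

/-- The vertices of the convex hull, in anticlockwise order. -/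
def hullCodes : List ℕ := List.range' 1 (t.rank - 3) ++ triangleCodes t g

/-- The vertices of the convex hull, in increasing order. -/
def sortedCodes : List ℕ := (hullCodes t g).insertionSort (fun a b => ltPt (g a) (g b) = true)

/-- The endpoints of the simple diagonals, where `q` is the list of the vertices of the convex
hull. -/
def simpleEnds (q : List ℕ) : ℕ → ℕ × ℕ
  -- The list `q` increases, so the top edge of the hull is at its end. Indices `0, 1, 2, 3, …`
  -- stand for `s₁, s₃, s₂, s₄, …`, which is Bourbaki order shifted to start at `0`.
  | 0 => (q.getD (t.rank - 2) 0, q.getD (t.rank - 1) 0)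
  | 1 => if ltPt (g 0) (g (t.coxeter + 2)) then (0, t.coxeter + 2) else (t.coxeter + 2, 0)
  | i + 2 => (q.getD (t.rank - 3 - i) 0, q.getD (t.rank - 2 - i) 0)

/-- A triangle two edges of which represent the simple diagonals at the ends of an edge of the
Dynkin diagram. -/
def simpleTriangle (q : List ℕ) : ℕ × ℕ → ℕ × ℕ × ℕ
  | (0, _) => (q.getD (t.rank - 2) 0, q.getD (t.rank - 1) 0, q.getD (t.rank - 3) 0)
  | (1, _) =>
      -- The point `v` is an endpoint of `s₄`. Since `V_0 W_2` and `W_3 V_{n-2}` are the same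
      -- lattice vector, `s₃` also has a representative ending at `v` when `v` is `V_{n-2}` or
      -- `W_3`.
      let v := q.getD (t.rank - 3) 0
      (v, if v = 0 then t.coxeter + 2 else if v = t.coxeter + 2 then 0
        else if v = t.rank - 2 then t.coxeter + 3 else t.rank - 2, q.getD (t.rank - 4) 0)
  | (i, _) => (q.getD (t.rank - 1 - i) 0, q.getD (t.rank - i) 0, q.getD (t.rank - 2 - i) 0)

/-- The vector of the root lattice with given endpoints. -/
def rootOf (p : ℕ × ℕ) : Fin 8 → ℤ := root t p.2 - root t p.1

/-- The number with given digits in base `4096`. -/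
def pack (l : List ℕ) : ℕ := l.foldr (fun a n => a + 4096 * n) 0

/-- The inverse of `pack`: the digits in base `4096`. -/
def digit (x c : ℕ) : ℕ := (x.div (Nat.pow 4096 c)).mod 4096

/-- The squared distances in the root lattice between the points of `localCodes`. -/
def packedDist : ℕ :=
  pack ((localCodes t).flatMap fun c => (localCodes t).map fun d =>
    (form (rootOf t (c, d)) (rootOf t (c, d))).toNat)

/-- Position in `localCodes`, which has `n + 3` entries: `W_1` comes right after `V_{n-2}`, at
position `n - 1`. -/
def localIndex (c : ℕ) : ℕ := if c < t.coxeter then c else c - t.coxeter + (t.rank - 2)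

def dist (D c d : ℕ) : ℕ := digit D ((t.rank + 3) * localIndex t c + localIndex t d)

theorem dist_eq : ∀ c ∈ localCodes t, ∀ d ∈ localCodes t,
    (dist t (packedDist t) c d : ℤ) = form (rootOf t (c, d)) (rootOf t (c, d)) := by
  cases t <;> decide +kernel

def isLocal (c : ℕ) : Bool :=
  Nat.blt c (t.rank - 1) || (Nat.blt t.coxeter c && Nat.blt c (t.coxeter + 5))

theorem mem_localCodes {c : ℕ} : c ∈ localCodes t ↔ isLocal t c = true := by
  simp only [localCodes, List.mem_append, List.mem_range, List.mem_range'_1, isLocal,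
    Bool.or_eq_true, Bool.and_eq_true, Nat.blt_eq]
  omega

/-! ### Computable conditions on a polygon -/

/-- The polygon is positively convex. -/
def checkConvex : Bool := (List.range t.coxeter).all fun j =>
  (List.range t.coxeter).all fun i =>
    i == (j + 1) % t.coxeter || i == j || leftOf (g j) (g ((j + 1) % t.coxeter)) (g j) (g i)

/-- The inner points are inside the level-`(n-3)` diagonal-gon. -/
def checkInner : Bool := (List.range t.coxeter).all fun j =>
  (List.range t.coxeter).all fun i =>
    leftOf (g j) (g ((j + (t.rank - 3)) % t.coxeter)) (g j) (g (t.coxeter + i))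

/-- `V_1, …, V_{n-3}` are the lowest points. -/
def checkBase : Bool := (List.range' 1 (t.rank - 3)).all fun b =>
  (List.range (2 * t.coxeter)).all fun c =>
    (Nat.ble 1 c && Nat.ble c (t.rank - 3)) || ltPt (g b) (g c)

/-- The points of `hullCodes` are in convex position, in this cyclic order. -/
def checkHull : Bool :=
  let l := hullCodes t g
  (List.range t.rank).all fun i =>
    -- The points `a` and `c` are the neighbours of `b`. All other points must lie strictly to the
    -- left of the parallel to `ac` through `b`, which makes `b` extreme.
    let a := l.getD ((i + (t.rank - 1)) % t.rank) 0
    let b := l.getD i 0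
    let c := l.getD ((i + 1) % t.rank) 0
    l.all fun r => r == b || leftOf (g a) (g c) (g b) (g r)

/-- The points of `q` are in increasing order. -/
def checkSorted (q : List ℕ) : Bool :=
  (List.range (t.rank - 1)).all fun i => ltPt (g (q.getD i 0)) (g (q.getD (i + 1) 0))

/-- The simple diagonals are upward, and their scalar products are those of simple roots. -/
def checkForm (D : ℕ) (q : List ℕ) : Bool := (List.range t.rank).all fun i =>
  let a := simpleEnds t g q i
  isLocal t a.1 && isLocal t a.2 && ltPt (g a.1) (g a.2) && Nat.beq (dist t D a.1 a.2) 2 &&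
    (List.range i).all fun j =>
      let b := simpleEnds t g q j
      -- Polarization: twice the scalar product is a signed sum of four squared distances, required
      -- to be `-2` for adjacent nodes and `0` otherwise.
      Nat.beq (dist t D a.1 b.2 + dist t D a.2 b.1 + bif adjacent j i then 2 else 0)
        (dist t D a.1 b.1 + dist t D a.2 b.2)

/-- The orientation of the quiver is encoded by the binary digits of a number. -/
def checkOrientation (q : List ℕ) (m : ℕ) : Bool :=
  (List.range (t.rank - 1)).all fun k =>
    let e := dynkinEdge k
    let a := simpleEnds t g q e.1
    let b := simpleEnds t g q e.2
    -- Bit `k` is set when `b` is clockwise from `a`, which will mean an arrow from `e.1` to `e.2`.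
    if m.testBit k then leftOf (g b.1) (g b.2) (g a.1) (g a.2)
    else leftOf (g a.1) (g a.2) (g b.1) (g b.2)

/-- The diagonals `p` and `e` are equivalent up to orientation. -/
def sameRoot (p e : ℕ × ℕ) : Bool :=
  p == e || p == e.swap || decide (rootOf t p = rootOf t e) || decide (rootOf t p = -rootOf t e)

/-- Simple diagonals that are adjacent in the Dynkin diagram span a triangle of admissible
diagonals. -/
def checkTriangles (D : ℕ) (q : List ℕ) : Bool := (List.range (t.rank - 1)).all fun k =>
  let e := dynkinEdge k
  let w := simpleTriangle t q e
  sameRoot t (w.1, w.2.1) (simpleEnds t g q e.1) && sameRoot t (w.1, w.2.2) (simpleEnds t g q e.2) &&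
    Nat.beq (dist t D w.2.1 w.2.2) 2 && isLocal t w.1 && isLocal t w.2.1 && isLocal t w.2.2

/-- All that has to be checked of a polygon with given points, such that its intersection quiver has
the orientation encoded by `m`. -/
def checkWith (m D : ℕ) (q : List ℕ) : Bool :=
  checkConvex t g && checkInner t g && checkBase t g && checkHull t g && checkSorted t g q &&
    checkForm t g D q && checkOrientation t g q m && checkTriangles t g D q &&
    (List.range t.coxeter).all fun k => decide (SeqRelAt t g k)

/-! ### Evaluation -/

/-- The value of `f` at `n`, where `n` is evaluated first. -/
def evalNat (n : ℕ) (f : ℕ → Bool) : Bool := Nat.rec (f 0) (fun k _ => f (k + 1)) n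

theorem evalNat_eq (n : ℕ) (f : ℕ → Bool) : evalNat n f = f n := by cases n <;> rfl

/-- The value of `f` at `l`, where `l` is evaluated first. -/
def evalList : List ℕ → (List ℕ → Bool) → Bool
  | [], f => f []
  | a :: l, f => evalNat a fun b => evalList l fun l' => f (b :: l')

theorem evalList_eq (l : List ℕ) (f : List ℕ → Bool) : evalList l f = f l := by
  induction l generalizing f with
  | nil => rfl
  | cons a l ih => rw [evalList, evalNat_eq, ih]

/-- The points whose coordinates are the digits of `x` and `y`. -/
def packedPts (x y : ℕ) : Pts := fun c => (digit x c, digit y c)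

def check (D x y m : ℕ) : Bool :=
  evalNat y fun y => evalList (sortedCodes t (packedPts x y)) fun q =>
    checkWith t (packedPts x y) m D q

def checkAll (x : ℕ) (y : ℕ → ℕ) : Bool :=
  evalNat (packedDist t) fun D => evalNat x fun x =>
    (List.range (2 ^ (t.rank - 1))).all fun m => check t D x (y m) m

theorem checkAll_eq {x : ℕ} {y : ℕ → ℕ} (h : checkAll t x y = true) {m : ℕ}
    (hm : m < 2 ^ (t.rank - 1)) :
    checkWith t (packedPts x (y m)) m (packedDist t) (sortedCodes t (packedPts x (y m))) = true := by
  simp only [checkAll, check, evalNat_eq, evalList_eq, List.all_eq_true, List.mem_range] at h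
  exact h m hm

end

/-! ### The polygons -/

/-- The abscissas of the vertices (one half of them, preceded by twice the centre, for `E₇` and
`E₈`). -/
def abscissas : ExcType → List ℕ
  | .E6 =>
    [1, 4, 8, 12, 15, 16, 15, 12, 8, 4, 1, 0]
  | .E7 =>
    [36, 4, 9, 15, 21, 27, 32, 35, 36, 35]
  | .E8 =>
    [118, 24, 35, 47, 59, 71, 83, 94, 103, 110, 115, 118, 118, 115, 110, 103]

/-- The part of the heights that depends on the orientation of the two shorter arms. -/
def shortTable : ExcType → List (List ℕ)
  | .E6 =>
    [[0, 0, 0, 0, 4, 3, 1, 3, 0, 0, 0, 0], [0, 0, 0, 0, 3, 3, 1, 2, 1, 0, 0, 1],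
     [2, 0, 0, 0, 1, 1, 1, 0, 1, 2, 0, 3], [3, 0, 0, 0, 1, 0, 1, 0, 0, 3, 0, 3],
     [1, 0, 0, 0, 3, 3, 0, 3, 0, 0, 1, 0], [1, 0, 0, 0, 2, 3, 0, 2, 1, 0, 1, 1],
     [3, 0, 0, 0, 0, 1, 0, 0, 1, 2, 1, 3], [4, 0, 0, 0, 0, 0, 0, 0, 0, 3, 1, 3]]
  | .E7 =>
    [[0, 0, 0, 0, 0, 0, 8, 7, 1, 7], [0, 0, 0, 0, 0, 0, 7, 7, 1, 6], [0, 6, 0, 0, 0, 0, 1, 1, 1, 0],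
     [0, 7, 0, 0, 0, 0, 1, 0, 1, 0], [0, 1, 0, 0, 0, 0, 7, 7, 0, 7], [0, 1, 0, 0, 0, 0, 6, 7, 0, 6],
     [0, 7, 0, 0, 0, 0, 0, 1, 0, 0], [0, 8, 0, 0, 0, 0, 0, 0, 0, 0]]
  | .E8 =>
    [[0, 0, 0, 0, 0, 0, 0, 10, 9, 1, 9, 10, 10, 9, 1, 9],
     [0, 0, 0, 0, 0, 0, 0, 9, 9, 1, 8, 10, 9, 9, 1, 8],
     [0, 8, 0, 0, 0, 0, 0, 1, 1, 1, 0, 2, 1, 1, 1, 0],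
     [0, 9, 0, 0, 0, 0, 0, 1, 0, 1, 0, 1, 1, 0, 1, 0],
     [0, 1, 0, 0, 0, 0, 0, 9, 9, 0, 9, 9, 9, 9, 0, 9],
     [0, 1, 0, 0, 0, 0, 0, 8, 9, 0, 8, 9, 8, 9, 0, 8],
     [0, 9, 0, 0, 0, 0, 0, 0, 1, 0, 0, 1, 0, 1, 0, 0],
     [0, 10, 0, 0, 0, 0, 0, 0, 0, 0, 0, 0, 0, 0, 0, 0]]

/-- The part of the heights that depends on the orientation of the longest arm. -/
def longTable : ExcType → List (List ℕ)
  | .E6 =>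
    [[7, 3, 1, 0, 7, 14, 23, 31, 33, 31, 26, 17], [7, 1, 0, 3, 7, 16, 26, 31, 33, 31, 24, 14],
     [7, 3, 0, 1, 7, 14, 24, 31, 33, 31, 26, 16], [7, 0, 1, 3, 7, 17, 26, 31, 33, 31, 23, 14]]
  | .E7 =>
    [[180, 27, 7, 3, 1, 0, 27, 54, 85, 112], [180, 27, 3, 1, 0, 7, 27, 58, 91, 119],
     [180, 27, 7, 1, 0, 3, 27, 54, 87, 115], [180, 27, 1, 0, 3, 7, 27, 60, 94, 119],
     [180, 27, 7, 3, 0, 1, 27, 54, 85, 113], [180, 27, 3, 0, 1, 7, 27, 58, 92, 119],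
     [180, 27, 7, 0, 1, 3, 27, 54, 88, 115], [180, 27, 0, 1, 3, 7, 27, 61, 94, 119]]
  | .E8 =>
    [[1714, 141, 15, 7, 3, 1, 0, 141, 276, 419, 558, 706, 983, 1126, 1273, 1414],
     [1714, 141, 7, 3, 1, 0, 15, 141, 284, 431, 572, 721, 991, 1138, 1287, 1429],
     [1714, 141, 15, 3, 1, 0, 7, 141, 276, 423, 564, 713, 983, 1130, 1279, 1421],
     [1714, 141, 3, 1, 0, 7, 15, 141, 288, 437, 579, 721, 995, 1144, 1294, 1429],
     [1714, 141, 15, 7, 1, 0, 3, 141, 276, 419, 560, 709, 983, 1126, 1275, 1417],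
     [1714, 141, 7, 1, 0, 3, 15, 141, 284, 433, 575, 721, 991, 1140, 1290, 1429],
     [1714, 141, 15, 1, 0, 3, 7, 141, 276, 425, 567, 713, 983, 1132, 1282, 1421],
     [1714, 141, 1, 0, 3, 7, 15, 141, 290, 440, 579, 721, 997, 1147, 1294, 1429],
     [1714, 141, 15, 7, 3, 0, 1, 141, 276, 419, 558, 707, 983, 1126, 1273, 1415],
     [1714, 141, 7, 3, 0, 1, 15, 141, 284, 431, 573, 721, 991, 1138, 1288, 1429],
     [1714, 141, 15, 3, 0, 1, 7, 141, 276, 423, 565, 713, 983, 1130, 1280, 1421],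
     [1714, 141, 3, 0, 1, 7, 15, 141, 288, 438, 579, 721, 995, 1145, 1294, 1429],
     [1714, 141, 15, 7, 0, 1, 3, 141, 276, 419, 561, 709, 983, 1126, 1276, 1417],
     [1714, 141, 7, 0, 1, 3, 15, 141, 284, 434, 575, 721, 991, 1141, 1290, 1429],
     [1714, 141, 15, 0, 1, 3, 7, 141, 276, 426, 567, 713, 983, 1133, 1282, 1421],
     [1714, 141, 0, 1, 3, 7, 15, 141, 291, 440, 579, 721, 998, 1147, 1294, 1429]]

/-- The low three bits of `m` orient the edges of the two shorter arms, the remaining bits those of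
the longest arm. The two contributions are independent and add up. -/
def heights (t : ExcType) (m : ℕ) : List ℕ :=
  List.zipWith (· + ·) ((shortTable t).getD (m % 8) []) ((longTable t).getD (m / 8) [])

/-- For `E₇` and `E₈` the head `c` is twice a coordinate of the centre, so opposite vertices have
coordinates with sum `c`. -/
def unfoldHalf : ExcType → List ℕ → List ℕ
  | .E6, l => l
  | _, [] => []
  | _, c :: l => l ++ l.map (c - ·)

/-- A coordinate of the inner point `W_k`, given the coordinates of the vertices. -/
def innerOf (t : ExcType) (l : List ℕ) (k : ℕ) : ℕ :=
  let p (i : ℕ) := l.getD ((k + i) % t.coxeter) 0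
  -- Truncation of the subtraction does no harm, since `checkWith` tests the resulting relations
  -- again.
  match t with
  | .E6 => p 0 + p 4 - p 3
  | .E7 => p 0 + p 5 - p 4
  | .E8 => p 1 + p 11 - p 10

def withInner (t : ExcType) (l : List ℕ) : List ℕ := l ++ (List.range t.coxeter).map (innerOf t l)

def packedRe (t : ExcType) : ℕ := pack (withInner t (unfoldHalf t (abscissas t)))

def packedIm (t : ExcType) (m : ℕ) : ℕ := pack (withInner t (unfoldHalf t (heights t m)))

theorem checkAll_E6 : checkAll .E6 (packedRe .E6) (packedIm .E6) = true := by decide +kernel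

theorem checkAll_E7 : checkAll .E7 (packedRe .E7) (packedIm .E7) = true := by decide +kernel

theorem checkAll_E8 : checkAll .E8 (packedRe .E8) (packedIm .E8) = true := by decide +kernel

/-! ### Plane geometry -/

theorem cross_swap (z w : ℂ) : cross w z = -cross z w := by simp [cross]; ring

/-- A point at which a linear functional has its strict minimum is extreme. -/
theorem mem_extremePoints_of_cross {S : Set ℂ} {p z : ℂ} (hp : p ∈ S)
    (h : ∀ r ∈ S, r = p ∨ 0 < cross z (r - p)) : p ∈ Set.extremePoints ℝ (convexHull ℝ S) := by
  -- The open half plane beyond `p`, together with `p` itself, is convex and contains `S`, hence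
  -- contains the hull.
  let T : Set ℂ := {r | r = p ∨ 0 < cross z (r - p)}
  have hT : ∀ r ∈ convexHull ℝ S, r ∈ T := by
    refine fun r hr => convexHull_min h ?_ hr
    rintro x hx y hy a b ha hb hab
    have hb' : b = 1 - a := by linarith
    have e : cross z (a • x + b • y - p) = a * cross z (x - p) + b * cross z (y - p) := by
      subst hb'; simp [cross]; ring
    change _ ∨ 0 < cross z (a • x + b • y - p)
    rw [e]
    rcases ha.eq_or_lt with rfl | ha
    · obtain rfl : b = 1 := by linarith
      have hy : y = p ∨ 0 < cross z (y - p) := hy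
      simpa using hy
    rcases hb.eq_or_lt with rfl | hb
    · obtain rfl : a = 1 := by linarith
      have hx : x = p ∨ 0 < cross z (x - p) := hx
      simpa using hx
    have nn : ∀ {r}, r ∈ T → 0 ≤ cross z (r - p) := by
      rintro r (rfl | hr)
      · simp [cross]
      · exact hr.le
    rcases hx with rfl | hx
    · rcases hy with rfl | hy
      · left
        rw [← add_smul, hab, one_smul]
      · right
        have := nn (r := x) (Or.inl rfl)
        positivity
    · right
      have := nn hy
      positivity
  rw [mem_extremePoints]
  refine ⟨subset_convexHull ℝ S hp, ?_⟩
  rintro x hx y hy ⟨a, b, ha, hb, hab, hp'⟩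
  have e : a * cross z (x - p) + b * cross z (y - p) = 0 := by
    have e' : a * cross z (x - p) + b * cross z (y - p) = cross z (a • x + b • y - p) := by
      obtain rfl : b = 1 - a := by linarith
      simp [cross]; ring
    rw [e', hp', sub_self]
    simp [cross]
  have nn : ∀ {r}, r ∈ T → 0 ≤ cross z (r - p) := by
    intro r hr
    rcases hr with hr | hr
    · simp [hr, cross]
    · exact hr.le
  constructor
  · rcases hT x hx with h | h
    · exact h
    · nlinarith [mul_pos ha h, mul_nonneg hb.le (nn (hT y hy))]
  · rcases hT y hy with h | h
    · exact h
    · nlinarith [mul_pos hb h, mul_nonneg ha.le (nn (hT x hx))]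

/-- Upward vectors with negative cross product have decreasing arguments. -/
theorem not_arg_lt_of_cross_neg {z w : ℂ} (hz : PLt 0 z) (hw : PLt 0 w) (h : cross z w < 0) :
    ¬ z.arg < w.arg := by
  have key : ∀ {z : ℂ}, PLt 0 z → 0 ≤ z.arg ∧ z.arg < Real.pi := by
    intro z hz
    rcases hz with hz | ⟨hz, hz'⟩
    · simp only [Complex.zero_im] at hz
      exact ⟨Complex.arg_nonneg_iff.2 hz.le, Complex.arg_lt_pi_iff.2 (.inr hz.ne')⟩
    · simp only [Complex.zero_im, Complex.zero_re] at hz hz'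
      exact ⟨Complex.arg_nonneg_iff.2 hz.le, Complex.arg_lt_pi_iff.2 (.inl hz'.le)⟩
  intro hlt
  have hs : 0 ≤ Real.sin (w.arg - z.arg) :=
    Real.sin_nonneg_of_nonneg_of_le_pi (by linarith) (by linarith [(key hz).1, (key hw).2])
  have e : cross z w = ‖z‖ * ‖w‖ * Real.sin (w.arg - z.arg) := by
    rw [cross, Real.sin_sub]
    linear_combination -(Complex.norm_mul_cos_arg z * (‖w‖ * Real.sin w.arg)
      + z.re * Complex.norm_mul_sin_arg w) + (Complex.norm_mul_sin_arg z * (‖w‖ * Real.cos w.arg)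
      + z.im * Complex.norm_mul_cos_arg w)
  rw [e] at h
  have : 0 ≤ ‖z‖ * ‖w‖ * Real.sin (w.arg - z.arg) := by positivity
  linarith

/-! ### Stability -/

section

variable {t : ExcType} {g : Pts} {G : HGon t}

theorem checkConvex_iff : checkConvex t g = true ↔ ∀ j < t.coxeter, ∀ i < t.coxeter,
    (i = (j + 1) % t.coxeter ∨ i = j) ∨
      0 < cross (natPt (g ((j + 1) % t.coxeter)) - natPt (g j)) (natPt (g i) - natPt (g j)) := by
  simp only [checkConvex, List.all_eq_true, List.mem_range, Bool.or_eq_true, beq_iff_eq, leftOf_iff]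

theorem checkInner_iff : checkInner t g = true ↔ ∀ j < t.coxeter, ∀ i < t.coxeter,
    0 < cross (natPt (g ((j + (t.rank - 3)) % t.coxeter)) - natPt (g j))
      (natPt (g (t.coxeter + i)) - natPt (g j)) := by
  simp only [checkInner, List.all_eq_true, List.mem_range, leftOf_iff]

theorem three_le_coxeter (t : ExcType) : 3 ≤ t.coxeter := by cases t <;> decide

/-- If an edge vanished, so would its cross product with the vector to the vertex after it; that
vertex is a third one because `h ≥ 3`. -/
theorem vtx_ne_of_check (h : checkConvex t g = true) (k : ℕ) :
    vtx t (fun c => natPt (g c)) (k + 1) ≠ vtx t (fun c => natPt (g c)) k := by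
  intro he
  have h3 := three_le_coxeter t
  have hk : k % t.coxeter < t.coxeter := Nat.mod_lt _ (by omega)
  have hi : (k % t.coxeter + 2) % t.coxeter < t.coxeter := Nat.mod_lt _ (by omega)
  have hj : (k % t.coxeter + 1) % t.coxeter < t.coxeter := Nat.mod_lt _ (by omega)
  rcases checkConvex_iff.1 h _ hk _ hi with h | h
  · have h1 := Nat.mod_add_div (k % t.coxeter + 2) t.coxeter
    have h2 := Nat.mod_add_div (k % t.coxeter + 1) t.coxeter
    have h4 : (k % t.coxeter + 2) / t.coxeter ≤ 1 := by
      rw [← Nat.lt_succ_iff, Nat.div_lt_iff_lt_mul (by omega)]; omega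
    have h5 : (k % t.coxeter + 1) / t.coxeter ≤ 1 := by
      rw [← Nat.lt_succ_iff, Nat.div_lt_iff_lt_mul (by omega)]; omega
    interval_cases (k % t.coxeter + 2) / t.coxeter <;>
      interval_cases (k % t.coxeter + 1) / t.coxeter <;> omega
  · have he' : natPt (g ((k % t.coxeter + 1) % t.coxeter)) = natPt (g (k % t.coxeter)) := by
      simpa [vtx] using he
    rw [he', sub_self] at h
    simp [cross] at h

theorem stable_of_check (hpt : ∀ P, G.pt P = natPt (g (code P))) (hc : checkConvex t g = true)
    (hi : checkInner t g = true) : G.Stable := by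
  have hv : ∀ j, G.vertex j = natPt (g j.val) := fun j => hpt (.V j)
  have hw : ∀ j, innerPoint t G.vertex j = natPt (g (t.coxeter + j.val)) := fun j => hpt (.W j)
  constructor
  · intro i j hij hij'
    obtain ⟨k, rfl⟩ : ∃ k, j = k + 1 := ⟨j - 1, by ring⟩
    have hk : (k + 1).val = (k.val + 1) % t.coxeter := by
      have : k + 1 = k + (1 : ℕ) := by simp
      rw [this, ZMod.val_add, ZMod.val_natCast, Nat.add_mod_mod]
    rw [add_sub_cancel_right] at hij' ⊢
    rcases checkConvex_iff.1 hc _ (ZMod.val_lt k) _ (ZMod.val_lt i) with (h | h) | h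
    · exact absurd (ZMod.val_injective _ (h.trans hk.symm)) hij
    · exact absurd (ZMod.val_injective _ h) hij'
    · rwa [edge, add_sub_cancel_right, hv, hv, hv, hk]
  · intro i j
    have := checkInner_iff.1 hi _ (ZMod.val_lt j) _ (ZMod.val_lt i)
    rwa [hv, hv, hw, ZMod.val_add, ZMod.val_natCast, Nat.add_mod_mod]

/-! ### The lowest vertices -/

theorem rank_lt_coxeter (t : ExcType) : t.rank < t.coxeter := by cases t <;> decide

theorem six_le_rank (t : ExcType) : 6 ≤ t.rank := by cases t <;> decide

theorem mem_bottom_iff {P : Label t} : P ∈ bottom t 0 ↔ 1 ≤ code P ∧ code P ≤ t.rank - 3 := by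
  have h := rank_lt_coxeter t
  constructor
  · rintro ⟨i, h1, h2, rfl⟩
    rw [zero_add]
    have : code (t := t) (.V (i : ZMod t.coxeter)) = i := by
      rw [code, ZMod.val_natCast, Nat.mod_eq_of_lt (by omega)]
    rw [this]
    exact ⟨h1, h2⟩
  · rintro ⟨h1, h2⟩
    refine ⟨code P, h1, h2, ?_⟩
    rw [zero_add, ← lab_of_lt (by omega), lab_code]

theorem isBase_of_check (hpt : ∀ P, G.pt P = natPt (g (code P))) (h : checkBase t g = true) :
    G.IsBase 0 := by
  intro P hP R hR
  rw [mem_bottom_iff] at hP hR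
  simp only [checkBase, List.all_eq_true, List.mem_range'_1, List.mem_range, Bool.or_eq_true,
    Bool.and_eq_true, Nat.ble_eq, ltPt_iff] at h
  rw [hpt, hpt]
  exact (h _ ⟨hP.1, by omega⟩ _ (code_lt R)).resolve_left hR

/-- Neither of two different cyclic windows of `n - 3` vertices contains the other. If both were
lowest, a vertex of each one outside the other would have to be below the other such vertex. -/
theorem exists_bottom_ne (t : ExcType) : ∀ k < t.coxeter, k ≠ 0 →
    (∃ i ∈ List.range' 1 (t.rank - 3), ∀ s ∈ List.range' 1 (t.rank - 3), (k + s) % t.coxeter ≠ i) ∧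
    ∃ i ∈ List.range' 1 (t.rank - 3), (k + i) % t.coxeter ∉ List.range' 1 (t.rank - 3) := by
  cases t <;> decide +kernel

/-- The base of a polygon is unique. -/
theorem HGon.IsBase.eq_zero (h0 : G.IsBase 0) {k : ZMod t.coxeter} (hk : G.IsBase k) : k = 0 := by
  by_contra hne
  have hr := rank_lt_coxeter t
  obtain ⟨⟨i, hi, hi'⟩, s, hs, hs'⟩ := exists_bottom_ne t k.val (ZMod.val_lt k)
    (by rwa [Ne, ZMod.val_eq_zero])
  simp only [List.mem_range'_1] at hi hi' hs hs'
  have hic : (i : ZMod t.coxeter).val = i := by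
    rw [ZMod.val_natCast, Nat.mod_eq_of_lt (by omega)]
  have hsc : (k + (s : ZMod t.coxeter)).val = (k.val + s) % t.coxeter := by
    rw [ZMod.val_add, ZMod.val_natCast, Nat.add_mod_mod]
  have a1 : Label.V (i : ZMod t.coxeter) ∈ bottom t 0 := ⟨i, hi.1, by omega, by simp⟩
  have a2 : Label.V (i : ZMod t.coxeter) ∉ bottom t k := by
    rintro ⟨s, h1, h2, he⟩
    refine hi' s ⟨h1, by omega⟩ ?_
    rw [← hic, Label.V.inj he, ZMod.val_add, ZMod.val_natCast, Nat.add_mod_mod]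
  have b1 : Label.V (k + (s : ZMod t.coxeter)) ∈ bottom t k := ⟨s, hs.1, by omega, rfl⟩
  have b2 : Label.V (k + (s : ZMod t.coxeter)) ∉ bottom t 0 := by
    rw [mem_bottom_iff]
    simp only [code, hsc]
    omega
  exact (h0 _ a1 _ b2).asymm (hk _ b1 _ a2)

/-! ### The convex hull -/

theorem mem_triangle_iff (hpt : ∀ P, G.pt P = natPt (g (code P))) {P : Label t} :
    P ∈ G.triangle 0 ↔ code P ∈ triangleCodes t g := by
  have hr := rank_lt_coxeter t
  have h3 := six_le_rank t
  have hV (i : ℕ) (hi : i < t.coxeter) : P = .V (i : ZMod t.coxeter) ↔ code P = i := by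
    rw [← code_injective.eq_iff, code, ZMod.val_natCast, Nat.mod_eq_of_lt hi]
  have hWc (i : ℕ) (hi : i < t.coxeter) : code (t := t) (.W (i : ZMod t.coxeter)) = t.coxeter + i := by
    rw [code, ZMod.val_natCast, Nat.mod_eq_of_lt hi]
  have hW (i : ℕ) (hi : i < t.coxeter) :
      P = .W (i : ZMod t.coxeter) ↔ code P = t.coxeter + i := by
    rw [← hWc i hi, code_injective.eq_iff]
  have e1 : (0 : ZMod t.coxeter) + 1 = (1 : ℕ) := by simp
  have e2 : (0 : ZMod t.coxeter) + 2 = (2 : ℕ) := by simp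
  have e3 : (0 : ZMod t.coxeter) + 3 = (3 : ℕ) := by simp
  have e4 : (0 : ZMod t.coxeter) + 4 = (4 : ℕ) := by simp
  have e0 : (0 : ZMod t.coxeter) = (0 : ℕ) := by simp
  unfold HGon.triangle triangleCodes
  rw [e1, e2, e3, e4, zero_add, hpt, hpt, hWc 1 (by omega), hWc 4 (by omega), ← ltPt_iff]
  split_ifs
  · simp only [Set.mem_insert_iff, Set.mem_singleton_iff, List.mem_cons, List.not_mem_nil, or_false]
    rw [e0, hV 0 (by omega), hW 1 (by omega), hW 3 (by omega)]
    tauto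
  · simp only [Set.mem_insert_iff, Set.mem_singleton_iff, List.mem_cons, List.not_mem_nil, or_false]
    rw [hV _ (by omega), hW 2 (by omega), hW 4 (by omega)]
    tauto

theorem mem_union_iff (hpt : ∀ P, G.pt P = natPt (g (code P))) {P : Label t} :
    P ∈ bottom t 0 ∪ G.triangle 0 ↔ code P ∈ hullCodes t g := by
  rw [Set.mem_union, mem_bottom_iff, mem_triangle_iff hpt, hullCodes, List.mem_append,
    List.mem_range'_1]
  have := six_le_rank t
  exact or_congr (by omega) Iff.rfl

theorem length_hullCodes : (hullCodes t g).length = t.rank := by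
  have := six_le_rank t
  unfold hullCodes triangleCodes
  split_ifs <;>
    simp only [List.length_append, List.length_range', List.length_cons, List.length_nil] <;> omega

/-- Each of the `n` candidates is the strict minimum of a linear functional, given by the chord of
its neighbours, so none is lost in passing to extreme points. -/
theorem mem_hullVertices_iff (hpt : ∀ P, G.pt P = natPt (g (code P))) (h : checkHull t g = true)
    {P : Label t} : P ∈ G.hullVertices 0 ↔ code P ∈ hullCodes t g := by
  rw [HGon.hullVertices, Set.mem_ofPred_eq, mem_union_iff hpt, and_iff_left_iff_imp]
  intro hP
  obtain ⟨i, hi, hiP⟩ := List.getElem_of_mem hP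
  simp only [checkHull, List.all_eq_true, List.mem_range, Bool.or_eq_true, beq_iff_eq,
    leftOf_iff] at h
  have h := h i (by rwa [← length_hullCodes (t := t) (g := g)])
  rw [List.getD_eq_getElem _ _ hi, hiP] at h
  refine mem_extremePoints_of_cross ⟨P, (mem_union_iff hpt).2 hP, rfl⟩
    (z := natPt (g ((hullCodes t g).getD ((i + 1) % t.rank) 0))
      - natPt (g ((hullCodes t g).getD ((i + (t.rank - 1)) % t.rank) 0))) ?_
  rintro _ ⟨R, hR, rfl⟩
  rcases h _ ((mem_union_iff hpt).1 hR) with h | h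
  · left; rw [code_injective h]
  · right; rwa [hpt, hpt]

/-! ### The simple diagonals -/

theorem mem_sortedCodes {c : ℕ} : c ∈ sortedCodes t g ↔ c ∈ hullCodes t g :=
  (List.perm_insertionSort _ _).mem_iff

theorem length_sortedCodes : (sortedCodes t g).length = t.rank :=
  (List.perm_insertionSort _ _).length_eq.trans length_hullCodes

theorem sorted_of_check {q : List ℕ} (h : checkSorted t g q = true) {i j : ℕ} (hij : i < j)
    (hj : j < t.rank) : PLt (natPt (g (q.getD i 0))) (natPt (g (q.getD j 0))) := by
  simp only [checkSorted, List.all_eq_true, List.mem_range, ltPt_iff] at h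
  induction j, hij using Nat.le_induction with
  | base => exact h i (by omega)
  | succ j hj' ih => exact (ih (by omega)).trans (h j (by omega))

theorem exists_simpleEnds_eq (t : ExcType) (g : Pts) (q : List ℕ) {a : ℕ} (ha : a + 1 < t.rank) :
    ∃ i < t.rank, i ≠ 1 ∧ simpleEnds t g q i = (q.getD a 0, q.getD (a + 1) 0) := by
  obtain rfl | h := eq_or_ne a (t.rank - 2)
  · refine ⟨0, by omega, by omega, ?_⟩
    rw [simpleEnds, show t.rank - 2 + 1 = t.rank - 1 by omega]
  · refine ⟨t.rank - 3 - a + 2, by omega, by omega, ?_⟩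
    rw [simpleEnds, show t.rank - 3 - (t.rank - 3 - a) = a by omega,
      show t.rank - 2 - (t.rank - 3 - a) = a + 1 by omega]

theorem simpleEnds_eq (t : ExcType) (g : Pts) (q : List ℕ) {i : ℕ} (hi : i < t.rank) (h1 : i ≠ 1) :
    ∃ a, a + 1 < t.rank ∧ simpleEnds t g q i = (q.getD a 0, q.getD (a + 1) 0) := by
  match i, h1 with
  | 0, _ =>
    have := six_le_rank t
    refine ⟨t.rank - 2, by omega, ?_⟩
    rw [simpleEnds, show t.rank - 2 + 1 = t.rank - 1 by omega]
  | i + 2, _ =>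
    refine ⟨t.rank - 3 - i, by omega, ?_⟩
    rw [simpleEnds, show t.rank - 3 - i + 1 = t.rank - 2 - i by omega]

/-- The diagonal with given codes of the endpoints. -/
def diagOf (t : ExcType) (p : ℕ × ℕ) : Diag t := Diag.mk (lab t p.1) (lab t p.2)

/-- The base is unique, so only `k = 0` counts. The `n` hull vertices are strictly ordered and give
`n - 1` consecutive pairs; `V_0 W_2` supplies the remaining diagonal. -/
theorem mem_sim_iff (hpt : ∀ P, G.pt P = natPt (g (code P))) (hb : checkBase t g = true)
    (hh : checkHull t g = true) (hs : checkSorted t g (sortedCodes t g) = true) {d : Diag t} :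
    d ∈ G.Sim ↔ ∃ i < t.rank, d = diagOf t (simpleEnds t g (sortedCodes t g) i) := by
  set q := sortedCodes t g with hq
  have hr := rank_lt_coxeter t
  have h6 := six_le_rank t
  have hlen : q.length = t.rank := length_sortedCodes
  have hbase := isBase_of_check hpt hb
  have hmem (P : Label t) : P ∈ G.hullVertices 0 ↔ ∃ a < t.rank, q.getD a 0 = code P := by
    rw [mem_hullVertices_iff hpt hh, ← mem_sortedCodes, ← hq, List.mem_iff_getElem]
    constructor
    · rintro ⟨a, ha, h⟩
      exact ⟨a, hlen ▸ ha, by rw [List.getD_eq_getElem _ _ ha, h]⟩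
    · rintro ⟨a, ha, h⟩
      rw [← hlen] at ha
      exact ⟨a, ha, by rw [← h, List.getD_eq_getElem _ _ ha]⟩
  have hlt {P Q : Label t} {a b : ℕ} (ha : a < t.rank) (hP : q.getD a 0 = code P)
      (hQ : q.getD b 0 = code Q) (h : PLt (G.pt P) (G.pt Q)) : a < b := by
    by_contra! hba
    rw [hpt, hpt, ← hP, ← hQ] at h
    rcases hba.eq_or_lt with rfl | hba
    · exact h.irrefl
    · exact h.asymm (sorted_of_check hs hba ha)
  have hup : G.up (.V 0) (.W (0 + 2)) = diagOf t (simpleEnds t g q 1) := by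
    have e0 : Label.V (0 : ZMod t.coxeter) = lab t 0 := by rw [lab_of_lt (by omega)]; simp
    have e2 : Label.W (0 + 2 : ZMod t.coxeter) = lab t (t.coxeter + 2) := by
      rw [lab_coxeter_add]; simp
    rw [e0, e2, HGon.up, simpleEnds, hpt, hpt, code_lab (by omega), code_lab (by omega), ← ltPt_iff]
    split_ifs <;> rfl
  constructor
  · rintro ⟨k, hk, h⟩
    obtain rfl := hbase.eq_zero hk
    rcases h with ⟨P, hP, Q, hQ, hPQ, hno, rfl⟩ | rfl
    · obtain ⟨a, ha, haP⟩ := (hmem P).1 hP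
      obtain ⟨b, hb, hbQ⟩ := (hmem Q).1 hQ
      have hab := hlt ha haP hbQ hPQ
      -- Otherwise the entry of `q` at `a + 1` would lie strictly between `P` and `Q`.
      obtain rfl : b = a + 1 := by
        by_contra hne
        have hc : q.getD (a + 1) 0 < 2 * t.coxeter := by
          by_contra! hc
          have hm : q.getD (a + 1) 0 ∈ q := by
            rw [List.getD_eq_getElem _ _ (by omega)]; exact List.getElem_mem _
          rw [mem_sortedCodes] at hm
          unfold hullCodes triangleCodes at hm
          split_ifs at hm <;>
            simp only [List.mem_append, List.mem_range'_1, List.mem_cons, List.not_mem_nil,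
              or_false] at hm <;> omega
        have hR : code (lab t (q.getD (a + 1) 0)) = q.getD (a + 1) 0 := code_lab hc
        refine hno (lab t (q.getD (a + 1) 0)) ((hmem _).2 ⟨a + 1, by omega, hR.symm⟩) ?_
        rw [hpt, hpt, hpt, hR, ← haP, ← hbQ]
        exact ⟨sorted_of_check hs (by omega) (by omega), sorted_of_check hs (by omega) (by omega)⟩
      obtain ⟨i, hi, -, he⟩ := exists_simpleEnds_eq t g q hb
      refine ⟨i, hi, ?_⟩
      rw [he, diagOf, haP, hbQ, lab_code, lab_code]
    · exact ⟨1, by omega, hup⟩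
  · rintro ⟨i, hi, rfl⟩
    refine ⟨0, hbase, ?_⟩
    by_cases h1 : i = 1
    · right; rw [h1, hup]
    left
    obtain ⟨a, ha, he⟩ := simpleEnds_eq t g q hi h1
    have hm (b : ℕ) (hb : b < t.rank) : q.getD b 0 = code (lab t (q.getD b 0)) := by
      refine (code_lab ?_).symm
      have hm : q.getD b 0 ∈ q := by
        rw [List.getD_eq_getElem _ _ (by omega)]; exact List.getElem_mem _
      rw [mem_sortedCodes] at hm
      unfold hullCodes triangleCodes at hm
      split_ifs at hm <;>
        simp only [List.mem_append, List.mem_range'_1, List.mem_cons, List.not_mem_nil,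
          or_false] at hm <;> omega
    refine ⟨lab t (q.getD a 0), (hmem _).2 ⟨a, by omega, hm a (by omega)⟩, lab t (q.getD (a + 1) 0),
      (hmem _).2 ⟨a + 1, ha, hm _ ha⟩, ?_, ?_, ?_⟩
    · rw [hpt, hpt, ← hm a (by omega), ← hm _ ha]
      exact sorted_of_check hs (by omega) ha
    · rintro R hR ⟨hR1, hR2⟩
      obtain ⟨b, hb, hbR⟩ := (hmem R).1 hR
      have := hlt (by omega) (hm a (by omega)) hbR hR1
      have := hlt hb hbR (hm _ ha) hR2
      omega
    · rw [he, diagOf]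

/-! ### Intersections of simple diagonals -/

theorem rvec_lab {c d : ℕ} (hc : c < 2 * t.coxeter) (hd : d < 2 * t.coxeter) :
    rvec (lab t c) (lab t d) = rootOf t (c, d) := by
  rw [rvec, rootOf, code_lab hc, code_lab hd]

/-- The adjacency relation of the Dynkin diagram. -/
def Adjacent (t : ExcType) (i j : ℕ) : Prop :=
  ∃ k < t.rank - 1, dynkinEdge k = (i, j) ∨ dynkinEdge k = (j, i)

theorem two_mul_form_rootOf (a b c d : ℕ) :
    2 * form (rootOf t (a, b)) (rootOf t (c, d)) =
      form (rootOf t (a, d)) (rootOf t (a, d)) + form (rootOf t (b, c)) (rootOf t (b, c))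
        - form (rootOf t (a, c)) (rootOf t (a, c)) - form (rootOf t (b, d)) (rootOf t (b, d)) := by
  simp only [rootOf, form, Pi.sub_apply]; ring

theorem adjacent_iff : ∀ j < t.rank, ∀ i < j, adjacent i j = true ↔ Adjacent t i j := by
  unfold Adjacent
  cases t <;> decide +kernel

theorem form_comm (x y : Fin 8 → ℤ) : form x y = form y x := by simp only [form]; ring

/-- What the check says about the lattice vectors of the simple diagonals. -/
theorem form_of_check {q : List ℕ} (h : checkForm t g (packedDist t) q = true) {i : ℕ}
    (hi : i < t.rank) :
    (simpleEnds t g q i).1 ∈ localCodes t ∧ (simpleEnds t g q i).2 ∈ localCodes t ∧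
      PLt (natPt (g (simpleEnds t g q i).1)) (natPt (g (simpleEnds t g q i).2)) ∧
      form (rootOf t (simpleEnds t g q i)) (rootOf t (simpleEnds t g q i)) = 2 ∧
      ∀ j < i, (Adjacent t j i →
          form (rootOf t (simpleEnds t g q i)) (rootOf t (simpleEnds t g q j)) = -1) ∧
        (¬ Adjacent t j i →
          form (rootOf t (simpleEnds t g q i)) (rootOf t (simpleEnds t g q j)) = 0) := by
  simp only [checkForm, List.all_eq_true, List.mem_range, Bool.and_eq_true, Nat.beq_eq,
    ← mem_localCodes, ltPt_iff] at h
  obtain ⟨⟨⟨⟨ha, ha'⟩, hlt⟩, h2⟩, hj⟩ := h i hi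
  refine ⟨ha, ha', hlt, ?_, fun j hji => ?_⟩
  · rw [← dist_eq t _ ha _ ha', h2]; rfl
  · obtain ⟨⟨⟨⟨hb, hb'⟩, -⟩, -⟩, -⟩ := h j (by omega)
    have e := hj j hji
    have key := two_mul_form_rootOf (t := t) (simpleEnds t g q i).1 (simpleEnds t g q i).2
      (simpleEnds t g q j).1 (simpleEnds t g q j).2
    rw [← dist_eq t _ ha _ hb', ← dist_eq t _ ha' _ hb, ← dist_eq t _ ha _ hb,
      ← dist_eq t _ ha' _ hb'] at key
    simp only [Prod.mk.eta] at key
    constructor <;> intro hadj <;> rw [← adjacent_iff i hi j hji] at hadj <;>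
      simp only [hadj, cond_true, cond_false] at e <;> omega

theorem form_simple {q : List ℕ} (h : checkForm t g (packedDist t) q = true) {i j : ℕ}
    (hi : i < t.rank) (hj : j < t.rank) :
    (Adjacent t i j →
        form (rootOf t (simpleEnds t g q i)) (rootOf t (simpleEnds t g q j)) = -1) ∧
      (¬ Adjacent t i j →
        form (rootOf t (simpleEnds t g q i)) (rootOf t (simpleEnds t g q j)) =
          if i = j then 2 else 0) := by
  have hirr : ∀ i, ¬ Adjacent t i i := by
    rintro i ⟨k, -, hk | hk⟩ <;>
    · match k with
      | 0 | 1 | 2 => simp [dynkinEdge] at hk; omega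
      | k + 3 => simp [dynkinEdge] at hk; omega
  have hsymm : ∀ {i j}, Adjacent t i j ↔ Adjacent t j i := by
    intro i j
    simp only [Adjacent, or_comm]
  obtain hij | rfl | hij := lt_trichotomy i j
  · rw [form_comm, if_neg hij.ne]
    exact (form_of_check h hj).2.2.2.2 i hij
  · exact ⟨fun h => absurd h (hirr i), fun _ => by
      rw [if_pos rfl]; exact (form_of_check h hi).2.2.2.1⟩
  · rw [if_neg hij.ne', hsymm]
    exact (form_of_check h hi).2.2.2.2 j hij

variable {q : List ℕ} {i j : ℕ}

theorem form_zsmul (a b : ℤ) (x y : Fin 8 → ℤ) : form (a • x) (b • y) = a * b * form x y := by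
  simp only [form, Pi.smul_apply, smul_eq_mul]; ring

theorem cross_zsmul (a b : ℤ) (z w : ℂ) : cross (a • z) (b • w) = a * b * cross z w := by
  simp [cross]; ring

/-- The lattice vectors of the simple diagonals. -/
def simpleRoot (t : ExcType) (g : Pts) (q : List ℕ) (i : ℕ) : Fin 8 → ℤ :=
  rootOf t (simpleEnds t g q i)

/-- The simple diagonals, as vectors in the plane. -/
noncomputable def simpleVec (t : ExcType) (g : Pts) (q : List ℕ) (i : ℕ) : ℂ :=
  natPt (g (simpleEnds t g q i).2) - natPt (g (simpleEnds t g q i).1)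

theorem rvec_simpleEnds (hF : checkForm t g (packedDist t) q = true) (hi : i < t.rank) :
    rvec (lab t (simpleEnds t g q i).1) (lab t (simpleEnds t g q i).2) = simpleRoot t g q i := by
  obtain ⟨h1, h2, -⟩ := form_of_check hF hi
  rw [rvec_lab (lt_of_mem_localCodes h1) (lt_of_mem_localCodes h2), simpleRoot]

theorem vec_simple (hpt : ∀ P, G.pt P = natPt (g (code P)))
    (hF : checkForm t g (packedDist t) q = true) (hi : i < t.rank) :
    G.vec (diagOf t (simpleEnds t g q i)) = simpleVec t g q i := by
  obtain ⟨h1, h2, -⟩ := form_of_check hF hi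
  change G.pt (lab t _) - G.pt (lab t _) = _
  rw [hpt, hpt, code_lab (lt_of_mem_localCodes h1), code_lab (lt_of_mem_localCodes h2), simpleVec]

theorem simpleVec_pos (hF : checkForm t g (packedDist t) q = true) (hi : i < t.rank) :
    PLt 0 (simpleVec t g q i) :=
  plt_iff_sub.1 (form_of_check hF hi).2.2.1

theorem admissible_simple (hF : checkForm t g (packedDist t) q = true) (hi : i < t.rank) :
    (diagOf t (simpleEnds t g q i)).Admissible := by
  obtain ⟨h1, h2, -, h, -⟩ := form_of_check hF hi
  exact admissible_of_form h1 h2 h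

/-- A lattice identity holds in the plane because the points come from a charge. -/
theorem pt_sub_of_rvec (hpt : ∀ P, G.pt P = natPt (g (code P)))
    (hF : checkForm t g (packedDist t) q = true) (hi : i < t.rank) {P X : Label t} {a : ℤ}
    (h : rvec P X = a • simpleRoot t g q i) : G.pt X - G.pt P = a • simpleVec t g q i := by
  obtain ⟨Z, hZ⟩ := G.exists_charge
  rw [hZ, h, map_zsmul, ← vec_simple hpt hF hi, ← rvec_simpleEnds hF hi, ← hZ]
  rfl

/-- Simple diagonals point upward, so passing to the upward version forgets precisely a sign. -/
theorem up_eq_iff (hpt : ∀ P, G.pt P = natPt (g (code P)))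
    (hF : checkForm t g (packedDist t) q = true) (hi : i < t.rank) {P X : Label t} :
    diagOf t (simpleEnds t g q i) = G.up P X ↔
      ∃ a : ℤˣ, rvec P X = (a : ℤ) • simpleRoot t g q i := by
  have hup : ∀ P X : Label t, diagOf t (simpleEnds t g q i) = Diag.mk P X ↔
      rvec P X = simpleRoot t g q i := by
    intro P X
    rw [diagOf, Diag.mk_eq_mk_iff, rvec_simpleEnds hF hi, eq_comm]
  rw [HGon.up]
  constructor
  · intro h
    split_ifs at h
    · exact ⟨1, by simpa using (hup P X).1 h⟩
    · exact ⟨-1, by rw [rvec_swap, (hup X P).1 h]; simp⟩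
  · rintro ⟨a, ha⟩
    have hpos := simpleVec_pos hF hi
    have hsub := pt_sub_of_rvec hpt hF hi ha
    obtain rfl | rfl := Int.units_eq_one_or a
    · simp only [Units.val_one, one_smul] at ha hsub
      rw [← hsub, ← plt_iff_sub] at hpos
      rwa [if_pos hpos, hup]
    · simp only [Units.val_neg, Units.val_one, neg_smul, one_smul] at ha hsub
      rw [← neg_eq_iff_eq_neg, neg_sub] at hsub
      rw [← hsub, ← plt_iff_sub] at hpos
      rw [if_neg hpos.asymm, hup, rvec_swap, ha, neg_neg]

/-- Expanding the norm of the third edge gives `ab(α, β) = 1`, where `(α, β)` is `2`, `-1` or `0`.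
Only the value `-1` allows this, and then the signs are opposite. -/
theorem units_mul_of_form_eq (hF : checkForm t g (packedDist t) q = true) (hi : i < t.rank)
    (hj : j < t.rank) {P X Y : Label t} {a b : ℤˣ} (ha : rvec P X = (a : ℤ) • simpleRoot t g q i)
    (hb : rvec P Y = (b : ℤ) • simpleRoot t g q j) (h : form (rvec X Y) (rvec X Y) = 2) :
    Adjacent t i j ∧ (a * b : ℤ) = -1 := by
  have hXY : rvec X Y = (b : ℤ) • simpleRoot t g q j - (a : ℤ) • simpleRoot t g q i := by
    rw [← ha, ← hb]; simp [rvec]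
  have hii : form (simpleRoot t g q i) (simpleRoot t g q i) = 2 := (form_of_check hF hi).2.2.2.1
  have hjj : form (simpleRoot t g q j) (simpleRoot t g q j) = 2 := (form_of_check hF hj).2.2.2.1
  obtain ⟨h1, h2⟩ := form_simple hF hi hj
  change _ → form (simpleRoot t g q i) (simpleRoot t g q j) = _ at h1 h2
  rw [hXY, form_sub_self, form_zsmul, form_zsmul, form_zsmul, hii, hjj, form_comm] at h
  by_cases hadj : Adjacent t i j
  · rw [h1 hadj] at h
    refine ⟨hadj, ?_⟩
    obtain rfl | rfl := Int.units_eq_one_or a <;> obtain rfl | rfl := Int.units_eq_one_or b <;>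
      simp at h ⊢
  · rw [h2 hadj] at h
    exfalso
    obtain rfl | rfl := Int.units_eq_one_or a <;> obtain rfl | rfl := Int.units_eq_one_or b <;>
      split_ifs at h <;> simp at h

theorem sameRoot_iff {p e : ℕ × ℕ} :
    sameRoot t p e = true ↔ ∃ a : ℤˣ, rootOf t p = (a : ℤ) • rootOf t e := by
  have key : (∃ a : ℤˣ, rootOf t p = (a : ℤ) • rootOf t e) ↔
      rootOf t p = rootOf t e ∨ rootOf t p = -rootOf t e := by
    constructor
    · rintro ⟨a, ha⟩
      obtain rfl | rfl := Int.units_eq_one_or a <;> simp [ha]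
    · rintro (h | h)
      · exact ⟨1, by simp [h]⟩
      · exact ⟨-1, by simp [h]⟩
  rw [key, sameRoot]
  simp only [Bool.or_eq_true, beq_iff_eq, decide_eq_true_eq]
  constructor
  · rintro (((rfl | rfl) | h) | h)
    · exact .inl rfl
    · exact .inr (by simp [rootOf])
    · exact .inl h
    · exact .inr h
  · rintro (h | h)
    · exact .inl (.inr h)
    · exact .inr h

theorem Adjacent.exists_triangle (hT : checkTriangles t g (packedDist t) q = true)
    (h : Adjacent t i j) :
    ∃ P X Y : Label t, (∃ a : ℤˣ, rvec P X = (a : ℤ) • simpleRoot t g q i) ∧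
      (∃ b : ℤˣ, rvec P Y = (b : ℤ) • simpleRoot t g q j) ∧ form (rvec X Y) (rvec X Y) = 2 ∧
      (Diag.mk X Y).Admissible := by
  obtain ⟨k, hk, h⟩ := h
  simp only [checkTriangles, List.all_eq_true, List.mem_range, Bool.and_eq_true, Nat.beq_eq,
    ← mem_localCodes, sameRoot_iff] at hT
  specialize hT k hk
  generalize dynkinEdge k = e at h hT
  obtain ⟨⟨⟨⟨⟨h1, h2⟩, hd⟩, hP⟩, hX⟩, hY⟩ := hT
  set w := simpleTriangle t q e
  have hd : form (rootOf t (w.2.1, w.2.2)) (rootOf t (w.2.1, w.2.2)) = 2 := by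
    rw [← dist_eq t _ hX _ hY, hd]; rfl
  have hd' : form (rootOf t (w.2.2, w.2.1)) (rootOf t (w.2.2, w.2.1)) = 2 := by
    rw [← hd]; simp only [form, rootOf, Pi.sub_apply]; ring
  have hP' := lt_of_mem_localCodes hP
  have hX' := lt_of_mem_localCodes hX
  have hY' := lt_of_mem_localCodes hY
  obtain rfl | rfl := h
  · refine ⟨lab t w.1, lab t w.2.1, lab t w.2.2, ?_⟩
    rw [rvec_lab hP' hX', rvec_lab hP' hY', rvec_lab hX' hY']
    exact ⟨h1, h2, hd, admissible_of_form hX hY hd⟩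
  · refine ⟨lab t w.1, lab t w.2.2, lab t w.2.1, ?_⟩
    rw [rvec_lab hP' hX', rvec_lab hP' hY', rvec_lab hY' hX']
    exact ⟨h2, h1, hd', admissible_of_form hY hX hd'⟩

/-- One of the two diagonals leaves `P` upward and the other downward. The opposite signs reverse
the cross product, so an anticlockwise angle at `P` means that the second diagonal is clockwise from
the first. -/
theorem essential_iff (hpt : ∀ P, G.pt P = natPt (g (code P)))
    (hF : checkForm t g (packedDist t) q = true) (hT : checkTriangles t g (packedDist t) q = true)
    (hi : i < t.rank) (hj : j < t.rank) :
    G.Essential (diagOf t (simpleEnds t g q i)) (diagOf t (simpleEnds t g q j)) ↔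
      Adjacent t i j ∧ cross (simpleVec t g q i) (simpleVec t g q j) < 0 := by
  have key {P X Y : Label t} {a b : ℤˣ} (ha : rvec P X = (a : ℤ) • simpleRoot t g q i)
      (hb : rvec P Y = (b : ℤ) • simpleRoot t g q j) (hab : (a * b : ℤ) = -1) :
      0 < cross (G.pt X - G.pt P) (G.pt Y - G.pt P) ↔
        cross (simpleVec t g q i) (simpleVec t g q j) < 0 := by
    rw [pt_sub_of_rvec hpt hF hi ha, pt_sub_of_rvec hpt hF hj hb, cross_zsmul, ← Int.cast_mul, hab]
    simp
  constructor
  · rintro ⟨-, -, P, X, Y, hX, hY, hXY, h⟩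
    obtain ⟨a, ha⟩ := (up_eq_iff hpt hF hi).1 hX
    obtain ⟨b, hb⟩ := (up_eq_iff hpt hF hj).1 hY
    obtain ⟨hadj, hab⟩ := units_mul_of_form_eq hF hi hj ha hb hXY.form_eq
    exact ⟨hadj, (key ha hb hab).1 h⟩
  · rintro ⟨hadj, h⟩
    obtain ⟨P, X, Y, hX, hY, hf, hXY⟩ := hadj.exists_triangle hT
    refine ⟨admissible_simple hF hi, admissible_simple hF hj, P, X, Y, (up_eq_iff hpt hF hi).2 hX,
      (up_eq_iff hpt hF hj).2 hY, hXY, ?_⟩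
    obtain ⟨a, ha⟩ := hX
    obtain ⟨b, hb⟩ := hY
    exact (key ha hb (units_mul_of_form_eq hF hi hj ha hb hf).2).2 h

/-- Equal simple roots would have scalar product `2`, whereas distinct indices give `-1` or `0`. -/
theorem diagOf_simpleEnds_injective (hF : checkForm t g (packedDist t) q = true) (hi : i < t.rank)
    (hj : j < t.rank) (h : diagOf t (simpleEnds t g q i) = diagOf t (simpleEnds t g q j)) :
    i = j := by
  rw [diagOf, diagOf, Diag.mk_eq_mk_iff, rvec_simpleEnds hF hi, rvec_simpleEnds hF hj] at h
  obtain ⟨h1, h2⟩ := form_simple hF hi hj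
  change _ → form (simpleRoot t g q i) (simpleRoot t g q j) = _ at h1 h2
  have hjj : form (simpleRoot t g q j) (simpleRoot t g q j) = 2 := (form_of_check hF hj).2.2.2.1
  rw [h, hjj] at h1 h2
  by_contra hne
  by_cases hadj : Adjacent t i j
  · simpa using h1 hadj
  · simpa [hne] using h2 hadj

theorem cross_of_check {m : ℕ} (hO : checkOrientation t g q m = true) {k : ℕ} (hk : k < t.rank - 1)
    (he : dynkinEdge k = (i, j)) :
    if m.testBit k then cross (simpleVec t g q i) (simpleVec t g q j) < 0
    else 0 < cross (simpleVec t g q i) (simpleVec t g q j) := by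
  simp only [checkOrientation, List.all_eq_true, List.mem_range] at hO
  have h := hO k hk
  rw [he] at h
  split_ifs at h ⊢
  · rw [leftOf_iff, cross_swap] at h
    exact neg_pos.1 h
  · exact leftOf_iff.1 h

/-! ### The polygon of an orientation -/

theorem checkAll_packed : checkAll t (packedRe t) (packedIm t) = true := by
  cases t
  exacts [checkAll_E6, checkAll_E7, checkAll_E8]

theorem lt_of_dynkinEdge {k : ℕ} (hk : k < t.rank - 1) (h : dynkinEdge k = (i, j)) :
    i < t.rank ∧ j < t.rank := by
  have := six_le_rank t
  match k with
  | 0 | 1 | 2 | k + 3 =>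
    simp only [dynkinEdge, Prod.mk.injEq] at h
    omega

/-- For every orientation `o` of the Dynkin diagram there is a stable polygon that has it as the
orientation of its intersection quiver. -/
theorem exists_hgon (t : ExcType) (o : ℕ → Prop) : ∃ (G : HGon t) (d : ℕ → Diag t),
    G.Stable ∧ (∀ a, a ∈ G.Sim ↔ ∃ i < t.rank, a = d i) ∧
      (∀ i < t.rank, ∀ j < t.rank, d i = d j → i = j) ∧
      (∀ k < t.rank - 1, ∀ i j, dynkinEdge k = (i, j) →
        (G.Essential (d i) (d j) ↔ o k) ∧ (G.Essential (d j) (d i) ↔ ¬ o k)) ∧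
      (∀ i < t.rank, ∀ j < t.rank, ¬ Adjacent t i j → ¬ G.Essential (d i) (d j)) ∧
      ∀ i < t.rank, ∀ j < t.rank, G.Essential (d i) (d j) → G.index (d i) (d j) = 1 := by
  classical
  -- The binary digits of `m` record the orientation, which selects one of the tabulated polygons.
  obtain ⟨m, hlt, hm⟩ : ∃ m < 2 ^ (t.rank - 1), ∀ k < t.rank - 1, (m.testBit k = true ↔ o k) :=
    ⟨Nat.ofBits fun k : Fin (t.rank - 1) => decide (o k), Nat.ofBits_lt_two_pow _, fun k hk => by
      rw [Nat.testBit_ofBits_lt _ _ hk, decide_eq_true_eq]⟩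
  have h := checkAll_eq t (checkAll_packed (t := t)) hlt
  simp only [checkWith, Bool.and_eq_true, List.all_eq_true, List.mem_range, decide_eq_true_eq] at h
  obtain ⟨⟨⟨⟨⟨⟨⟨⟨hconv, hinn⟩, hbase⟩, hhull⟩, hsort⟩, hF⟩, hO⟩, hT⟩, hrel⟩ := h
  set g := packedPts (packedRe t) (packedIm t m)
  let G := gonOf t (fun c => natPt (g c)) ((SeqRel.of_lt hrel).map natPt) (vtx_ne_of_check hconv)
  have hpt : ∀ P, G.pt P = natPt (g (code P)) := pt_gonOf _ _ _ _
  have hess := fun {i j : ℕ} => essential_iff (i := i) (j := j) hpt hF hT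
  refine ⟨G, fun i => diagOf t (simpleEnds t g (sortedCodes t g) i), stable_of_check hpt hconv hinn,
    fun a => mem_sim_iff hpt hbase hhull hsort,
    fun i hi j hj => diagOf_simpleEnds_injective hF hi hj, fun k hk i j he => ?_,
    fun i hi j hj hadj h => hadj ((hess hi hj).1 h).1, fun i hi j hj h => ?_⟩
  · obtain ⟨hi, hj⟩ := lt_of_dynkinEdge hk he
    have hc := cross_of_check hO hk he
    rw [hess hi hj, hess hj hi, ← hm k hk, cross_swap (simpleVec t g _ i), neg_neg_iff_pos]
    have h1 : Adjacent t i j := ⟨k, hk, .inl he⟩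
    have h2 : Adjacent t j i := ⟨k, hk, .inr he⟩
    split_ifs at hc with hk
    · simp [h1, hk, hc, hc.le]
    · simp [h2, hk, hc, hc.le]
  · rw [HGon.index, if_neg]
    rw [vec_simple hpt hF hi, vec_simple hpt hF hj]
    exact not_arg_lt_of_cross_neg (simpleVec_pos hF hi) (simpleVec_pos hF hj) ((hess hi hj).1 h).2

/-- Both sides follow Bourbaki numbering, with indices starting at `0`; this links the definition of
the quiver type to the encoded Dynkin edges. -/
theorem cartan_eq_neg_one_iff (i j : Fin t.rank) : t.cartan i j = -1 ↔ Adjacent t i j := by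
  rw [← Int.beq'_eq]
  revert i j
  unfold Adjacent
  cases t with
  | E6 =>
    change ∀ i j : Fin 6, Int.beq' (CartanMatrix.E₆ i j) (-1) = true ↔
      ∃ k < 5, dynkinEdge k = (↑i, ↑j) ∨ dynkinEdge k = (↑j, ↑i)
    decide +kernel
  | E7 =>
    change ∀ i j : Fin 7, Int.beq' (CartanMatrix.E₇ i j) (-1) = true ↔
      ∃ k < 6, dynkinEdge k = (↑i, ↑j) ∨ dynkinEdge k = (↑j, ↑i)
    decide +kernel
  | E8 =>
    change ∀ i j : Fin 8, Int.beq' (CartanMatrix.E₈ i j) (-1) = true ↔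
      ∃ k < 7, dynkinEdge k = (↑i, ↑j) ∨ dynkinEdge k = (↑j, ↑i)
    decide +kernel

end

end ExcGon

theorem mainTheorem4 (t : ExcGon.ExcType) (Q : Type u) [Quiver.{v} Q]
    (hQ : ExcGon.IsQuiverOfType t Q) :
    ∃ G : ExcGon.HGon t, G.Stable ∧
      Nonempty (G.intersectionQuiver.gradingChange.Iso (ExcGon.GradedQuiver.ofQuiver Q)) := by
  classical
  obtain ⟨e, hQ⟩ := hQ
  simp only [ExcGon.cartan_eq_neg_one_iff] at hQ
  -- The prescribed orientation: edge `k` points from its first to its second node when `Q` has such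
  -- an arrow.
  obtain ⟨G, d, hG, hsim, hinj, hedge, hnon, hindex⟩ := ExcGon.exists_hgon t fun k =>
    ∃ a b : Q, ExcGon.dynkinEdge k = (↑(e a), ↑(e b)) ∧ Nonempty (a ⟶ b)
  have hsub (a b : Q) : Subsingleton (a ⟶ b) := by
    have h := hQ a b
    split_ifs at h
    · obtain ⟨h⟩ := h
      exact ⟨fun x y => Sum.inl_injective (Subsingleton.elim (α := (a ⟶ b) ⊕ (b ⟶ a)) _ _)⟩
    · infer_instance
  -- The unique element of the sum of both arrow types lies on exactly one side.
  have hone {a b : Q} (h : ExcGon.Adjacent t (e a) (e b)) :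
      Nonempty (b ⟶ a) ↔ ¬ Nonempty (a ⟶ b) := by
    have hab := hQ a b
    rw [if_pos h] at hab
    obtain ⟨hab⟩ := hab
    constructor
    · rintro ⟨x⟩ ⟨y⟩
      exact Sum.inl_ne_inr (Subsingleton.elim (α := (a ⟶ b) ⊕ (b ⟶ a)) (.inl y) (.inr x))
    · intro hn
      obtain x | x := hab.default
      · exact absurd ⟨x⟩ hn
      · exact ⟨x⟩
  have hess (a b : Q) : G.Essential (d (e a)) (d (e b)) ↔ Nonempty (a ⟶ b) := by
    have key {a b : Q} {k : ℕ} (he : ExcGon.dynkinEdge k = (↑(e a), ↑(e b))) :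
        (∃ a b : Q, ExcGon.dynkinEdge k = (↑(e a), ↑(e b)) ∧ Nonempty (a ⟶ b)) ↔
          Nonempty (a ⟶ b) := by
      refine ⟨?_, fun h => ⟨a, b, he, h⟩⟩
      rintro ⟨a', b', he', h⟩
      rw [he, Prod.mk.injEq] at he'
      rwa [e.injective (Fin.ext he'.1), e.injective (Fin.ext he'.2)]
    by_cases hadj : ExcGon.Adjacent t (e a) (e b)
    · obtain ⟨k, hk, he | he⟩ := hadj
      · rw [(hedge k hk _ _ he).1, key he]
      · rw [(hedge k hk _ _ he).2, key he, hone ⟨k, hk, .inl he⟩]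
    · refine iff_of_false (hnon _ (e a).2 _ (e b).2 hadj) ?_
      have h := hQ a b
      rw [if_neg hadj] at h
      exact not_nonempty_iff.2 h
  let φ : Q ≃ G.Sim := Equiv.ofBijective (fun a => ⟨d (e a), (hsim _).2 ⟨e a, (e a).2, rfl⟩⟩) <| by
    constructor
    · intro a b h
      exact e.injective (Fin.ext (hinj _ (e a).2 _ (e b).2 (Subtype.ext_iff.1 h)))
    · rintro ⟨x, hx⟩
      obtain ⟨i, hi, rfl⟩ := (hsim x).1 hx
      exact ⟨e.symm ⟨i, hi⟩, by simp⟩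
  have harr (x y : G.Sim) : G.Essential x y ↔ Nonempty (φ.symm x ⟶ φ.symm y) := by
    obtain ⟨a, rfl⟩ := φ.surjective x
    obtain ⟨b, rfl⟩ := φ.surjective y
    rw [φ.symm_apply_apply, φ.symm_apply_apply]
    exact hess a b
  -- All arrows have index `1`, so the change `? ↦ 1 - ?` produces the trivial grading.
  have hdeg (x y : G.Sim) (h : G.Essential x y) : (0 : ℤ) = 1 - G.index x y := by
    obtain ⟨i, hi, hx⟩ := (hsim x).1 x.2
    obtain ⟨j, hj, hy⟩ := (hsim y).1 y.2
    rw [hx, hy] at h ⊢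
    rw [hindex i hi j hj h, sub_self]
  exact ⟨G, hG, ⟨{
    onVertex := φ.symm
    onArrow := fun x y =>
      { toFun := fun h => ((harr x y).1 h.down).some
        invFun := fun f => ⟨(harr x y).2 ⟨f⟩⟩
        left_inv := fun _ => rfl
        right_inv := fun _ => (hsub _ _).elim _ _ }
    deg_eq := fun x y h => hdeg x y h.down }⟩⟩
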